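/- Fix $t\in\mathbb C\setminus\{0\}$ and put $\mathsf c=3\frac{t-2}{t}$. For $\theta\in\mathbb C$ let $\mathcal A_\theta$ be the $N=2$ superconformal algebra (in the twisted basis, with central charge $\mathsf c$) spanned by $\mathcal L_m,\mathcal H_m$ ($m\in\mathbb Z$), $\mathcal G_\nu$ ($\nu\in\theta+\mathbb Z$), $\mathcal Q_\lambda$ ($\lambda\in-\theta+\mathbb Z$) with $$[\mathcal L_m,\mathcal L_n]=(m-n)\mathcal L_{m+n},\quad [\mathcal H_m,\mathcal H_n]=\tfrac{\mathsf c}{3}m\,\delta_{m+n,0},\quad [\mathcal L_m,\mathcal G_\nu]=(m-\nu)\mathcal G_{m+\nu},\quad [\mathcal H_m,\mathcal G_\nu]=\mathcal G_{m+\nu},$$ $$[\mathcal L_m,\mathcal Q_\lambda]=-\lambda\mathcal Q_{m+\lambda},\quad [\mathcal H_m,\mathcal Q_\lambda]=-\mathcal Q_{m+\lambda},\quad [\mathcal L_m,\mathcal H_n]=-n\mathcal H_{m+n}+\tfrac{\mathsf c}{6}(m^2+m)\delta_{m+n,0},$$ $$\{\mathcal G_\nu,\mathcal Q_\lambda\}=2\mathcal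 L_{\nu+\lambda}-2\lambda\mathcal H_{\nu+\lambda}+\tfrac{\mathsf c}{3}(\nu^2+\nu)\delta_{\nu+\lambda,0},\qquad \{\mathcal G_\mu,\mathcal G_\nu\}=\{\mathcal Q_\mu,\mathcal Q_\nu\}=0 .$$ Note that $\mathcal A_{\theta}=\mathcal A_{\theta+1}$. A vector $v$ of an $\mathcal A_\theta$-module satisfies the *generalized massive highest-weight conditions* with parameters $(h,\ell,t;\theta)$ if $\mathcal L_mv=\mathcal H_mv=0$ ($m\ge1$), $\mathcal Q_{-\theta+p}v=0$ ($p\ge1$), $\mathcal G_{\theta+p}v=0$ ($p\ge0$), $(\mathcal H_0+\frac{\mathsf c}{3}\theta)v=hv$ and $(\mathcal L_0+\theta\mathcal H_0+\frac{\mathsf c}{6}(\theta^2+\theta))v=\ell v$; it satisfies the *generalized topological highest-weight conditions* with parameters $(h,t;\theta)$ if the same holds with $\ell=0$ and, in addition, $\mathcal Q_{-\theta}v=0$. A *generalized massive Verma module* is an $\mathcal A_\theta$-module freely generated from such a massive vector $v$ by $\mathcal L_{-m},\mathcal H_{-m},\mathcal Q_{-\theta-m+1},\mathcal G_{\theta-m}$,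 $m\ge1$ (the ordered monomials in these operators, applied to $v$, form a basis). *Continued operators.* Let $V$ be an $\mathcal A_\theta$-module and $v\in V$. For an integer $N\ge0$ put $g(\theta-N,\theta-1)v=\mathcal G_{\theta-N}\cdots\mathcal G_{\theta-1}v$ and $q(-\theta-N+1,-\theta)v=\mathcal Q_{-\theta-N+1}\cdots\mathcal Q_{-\theta}v$. For complex $\theta'$ the states $g(\theta',\theta-1)v$, of length $z=\theta-\theta'$, are defined by algebraic continuation: the symbols $g(\theta'+k,\theta-1)v$, $k\in\mathbb Z$, generate a space acted on by words in $\mathcal L_m,\mathcal H_m,\mathcal G_{\theta'+n},\mathcal Q_{-\theta'+n}$, and they are subject precisely to the consequences of the following relations. (i) For all finite families of polynomials $p_i\in\mathbb C[X]$, integers $k_i$ and words $w_i$ in letters labelled relative to $\theta'$, the relation $\sum_i p_i(\theta-\theta')\,w_i\,g(\theta'+k_i,\theta-1)v=0$ is imposed if it is true in $V$ for $\theta'=\theta-N$ for all sufficiently large integers $N$. (ii) If $\theta-\theta'\in\mathbb Z$, all linear relations in $V$ between words applied to actual products of modes, $g(\theta-N,\theta-1)v$ with $N\ge0$, are imposed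 as well. The states $q(-\theta',-\theta)v$, of length $z=\theta'-\theta+1$, are defined in the same way from the products of modes $\mathcal Q$. **Theorem.** Let $\theta,\theta',h,\ell\in\mathbb C$, let $V$ be an $\mathcal A_\theta$-module and let $v=|h,\ell,t;\theta\rangle\in V$ satisfy the generalized massive highest-weight conditions with parameters $(h,\ell,t;\theta)$. Put $\Lambda(x,h,\ell,t)=2\bigl(\ell+xh-\frac1t(x^2+x)\bigr)$. 1. The continued states built from $g(\theta',\theta-1)v$ form an $\mathcal A_{\theta'}$-module, in which $g(\theta',\theta-1)v$ satisfies the generalized massive highest-weight conditions with parameters $(h',\ell',t;\theta')$, where $$h'=h+\tfrac2t(\theta-\theta'),\qquad \ell'=\ell+(\theta'-\theta)\bigl(h-\tfrac1t(\theta'-\theta+1)\bigr).$$ It is non-zero if and only if all the products $\mathcal G_{\theta-N}\cdots\mathcal G_{\theta-1}v$, $N\ge0$, are non-zero; in particular it is non-zero whenever $V$ is the generalized massive Verma module freely generated from $v$. If $\Lambda(\theta'-\theta,h,\ell,t)=0$, it satisfies the generalized topological highest-weight conditions with parameters $(h',t;\theta')$. Conversely, if it is non-zero and satisfies generalized topological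 highest-weight conditions with twist $\theta'$, then $\Lambda(\theta'-\theta,h,\ell,t)=0$. 2. The continued states built from $q(-\theta',-\theta)v$ form an $\mathcal A_{\theta'}$-module, in which $q(-\theta',-\theta)v$ satisfies the generalized massive highest-weight conditions with parameters $(h'',\ell'',t;\theta'+1)$, where $$h''=h+\tfrac2t(\theta-\theta'-1),\qquad \ell''=\ell+(\theta'-\theta+1)\bigl(h-\tfrac1t(\theta'-\theta+2)\bigr).$$ It is non-zero if and only if all the products $\mathcal Q_{-\theta-N+1}\cdots\mathcal Q_{-\theta}v$, $N\ge0$, are non-zero; in particular it is non-zero whenever $V$ is the generalized massive Verma module freely generated from $v$. If $\Lambda(\theta'-\theta,h,\ell,t)=0$, it satisfies the generalized topological highest-weight conditions with parameters $(h+\frac2t(\theta-\theta')-1,t;\theta')$. Conversely, if it is non-zero and satisfies generalized topological highest-weight conditions with twist $\theta'$, then $\Lambda(\theta'-\theta,h,\ell,t)=0$. 3. In the case of an integral length $N\ge0$ (that is, $\theta'=\theta-N$ in 1 and $\theta'=\theta+N-1$ in 2), the product of modes applied to $v$, as an element of $V$ itself, satisfies the massive highest-weight conditions of 1 and 2, and,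 if moreover $N\ge1$ and $\Lambda(\theta'-\theta,h,\ell,t)=0$, the topological ones. -/

import Mathlib

/-- Labels for the generators of an `N = 2` algebra `A_θ`.  Relative to the twist `θ`,
`L n`, `H n`, `Q n`, `G n` stand for `𝓛_n`, `𝓗_n`, `𝓠_{-θ+n}`, `𝓖_{θ+n}`. -/
inductive Mode : Type
  | L (n : ℤ)
  | H (n : ℤ)
  | Q (n : ℤ)
  | G (n : ℤ)

/-- The central charge `c = 3 (t - 2) / t`. -/
noncomputable def centralCharge (t : ℂ) : ℂ := 3 * (t - 2) / t

section Modules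

variable {V : Type*} [AddCommGroup V] [Module ℂ V]

/-- The operators `ρ` make `V` a module over the `N = 2` superconformal algebra `A_θ`
with central charge `c = 3 (t - 2) / t`. -/
structure IsN2Module (t θ : ℂ) (ρ : Mode → Module.End ℂ V) : Prop where
  LL : ∀ m n : ℤ, ρ (.L m) * ρ (.L n) - ρ (.L n) * ρ (.L m) =
    ((m : ℂ) - n) • ρ (.L (m + n))
  HH : ∀ m n : ℤ, ρ (.H m) * ρ (.H n) - ρ (.H n) * ρ (.H m) =
    (if m + n = 0 then centralCharge t / 3 * m else 0) • (1 : Module.End ℂ V)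
  LG : ∀ m n : ℤ, ρ (.L m) * ρ (.G n) - ρ (.G n) * ρ (.L m) =
    ((m : ℂ) - (θ + n)) • ρ (.G (m + n))
  HG : ∀ m n : ℤ, ρ (.H m) * ρ (.G n) - ρ (.G n) * ρ (.H m) = ρ (.G (m + n))
  LQ : ∀ m n : ℤ, ρ (.L m) * ρ (.Q n) - ρ (.Q n) * ρ (.L m) =
    (-(-θ + n)) • ρ (.Q (m + n))
  HQ : ∀ m n : ℤ, ρ (.H m) * ρ (.Q n) - ρ (.Q n) * ρ (.H m) = -ρ (.Q (m + n))
  LH : ∀ m n : ℤ, ρ (.L m) * ρ (.H n) - ρ (.H n) * ρ (.L m) =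
    (-(n : ℂ)) • ρ (.H (m + n)) +
      (if m + n = 0 then centralCharge t / 6 * ((m : ℂ) ^ 2 + m) else 0) •
        (1 : Module.End ℂ V)
  GQ : ∀ m n : ℤ, ρ (.G m) * ρ (.Q n) + ρ (.Q n) * ρ (.G m) =
    (2 : ℂ) • ρ (.L (m + n)) - (2 * (-θ + n)) • ρ (.H (m + n)) +
      (if m + n = 0 then centralCharge t / 3 * ((θ + m) ^ 2 + (θ + m)) else 0) •
        (1 : Module.End ℂ V)
  GG : ∀ m n : ℤ, ρ (.G m) * ρ (.G n) + ρ (.G n) * ρ (.G m) = 0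
  QQ : ∀ m n : ℤ, ρ (.Q m) * ρ (.Q n) + ρ (.Q n) * ρ (.Q m) = 0

/-- The algebras `A_θ` and `A_{θ+j}`, `j ∈ ℤ`, have the same generators; `rebase j` replaces
labels relative to `θ` by labels relative to `θ + j`. -/
def rebase (j : ℤ) (ρ : Mode → Module.End ℂ V) : Mode → Module.End ℂ V
  | .L n => ρ (.L n)
  | .H n => ρ (.H n)
  | .Q n => ρ (.Q (n - j))
  | .G n => ρ (.G (n + j))

/-- The generalized massive highest-weight conditions on `|h, ℓ, t; θ⟩`, `θ ∈ ℂ`. -/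
structure IsMassiveHW (t θ : ℂ) (ρ : Mode → Module.End ℂ V) (h ℓ : ℂ) (v : V) : Prop where
  L_pos : ∀ m : ℤ, 1 ≤ m → ρ (.L m) v = 0
  H_pos : ∀ m : ℤ, 1 ≤ m → ρ (.H m) v = 0
  Q_pos : ∀ p : ℤ, 1 ≤ p → ρ (.Q p) v = 0
  G_nonneg : ∀ p : ℤ, 0 ≤ p → ρ (.G p) v = 0
  H_zero : ρ (.H 0) v + (centralCharge t / 3 * θ) • v = h • v
  L_zero : ρ (.L 0) v + θ • ρ (.H 0) v + (centralCharge t / 6 * (θ ^ 2 + θ)) • v = ℓ • v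

/-- The generalized topological highest-weight conditions on `|h, t; θ⟩_top`, `θ ∈ ℂ`. -/
structure IsTopologicalHW (t θ : ℂ) (ρ : Mode → Module.End ℂ V) (h : ℂ) (v : V) : Prop where
  L_pos : ∀ m : ℤ, 1 ≤ m → ρ (.L m) v = 0
  H_pos : ∀ m : ℤ, 1 ≤ m → ρ (.H m) v = 0
  Q_nonneg : ∀ p : ℤ, 0 ≤ p → ρ (.Q p) v = 0
  G_nonneg : ∀ p : ℤ, 0 ≤ p → ρ (.G p) v = 0
  H_zero : ρ (.H 0) v + (centralCharge t / 3 * θ) • v = h • v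
  L_zero : ρ (.L 0) v + θ • ρ (.H 0) v + (centralCharge t / 6 * (θ ^ 2 + θ)) • v = 0

/-- The operator of a word of generators. -/
def wordOp (ρ : Mode → Module.End ℂ V) (w : List Mode) : Module.End ℂ V := (w.map ρ).prod

/-- The ordered monomial in the creation operators `𝓛_{-m}`, `𝓗_{-m}` (`m ≥ 1`, with
multiplicities `a (m - 1)`, `b (m - 1)`), `𝓠_{-θ-i}` (`i ∈ S`) and `𝓖_{θ-1-i}` (`i ∈ T`). -/
noncomputable def creationMonomial (ρ : Mode → Module.End ℂ V)
    (x : (ℕ →₀ ℕ) × (ℕ →₀ ℕ) × Finset ℕ × Finset ℕ) : Module.End ℂ V :=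
  ((x.1.support.sort (· ≥ ·)).map fun i : ℕ => ρ (.L (-((i : ℤ) + 1))) ^ x.1 i).prod *
  ((x.2.1.support.sort (· ≥ ·)).map fun i : ℕ => ρ (.H (-((i : ℤ) + 1))) ^ x.2.1 i).prod *
  ((x.2.2.1.sort (· ≥ ·)).map fun i : ℕ => ρ (.Q (-(i : ℤ)))).prod *
  ((x.2.2.2.sort (· ≥ ·)).map fun i : ℕ => ρ (.G (-((i : ℤ) + 1)))).prod

/-- `V` is the generalized massive Verma module `U_{h,ℓ,t;θ}`: it is freely generated by the
creation operators from the generalized massive highest-weight vector `v`. -/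
structure IsMassiveVerma (t θ : ℂ) (ρ : Mode → Module.End ℂ V) (h ℓ : ℂ) (v : V) : Prop where
  isN2Module : IsN2Module t θ ρ
  isMassiveHW : IsMassiveHW t θ ρ h ℓ v
  linearIndependent : LinearIndependent ℂ fun x => creationMonomial ρ x v
  span_eq_top : Submodule.span ℂ (Set.range fun x => creationMonomial ρ x v) = ⊤

end Modules

/-! ### Continued products of fermionic modes -/

/-- The two kinds of continued operators. -/
inductive Fermion : Type
  | g
  | q

/-- A product of `N` modes `𝓖` (resp. `𝓠`) changes the twist by `-N` (resp. `+N`). -/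
def Fermion.sign : Fermion → ℤ
  | .g => -1
  | .q => 1

/-- Formal states: finite linear combinations of symbols `w ⬝ e_k`, with `w` a word of generators
and `k ∈ ℤ`.  When the length of the fermionic product is `z`, the symbol `e_k` stands for the
product of length `z + k` applied to the vector `v`: for `Fermion.g`, this is
`g(θ-z-k, θ-1) v`, and for `Fermion.q`, this is `q(-θ-z-k+1, -θ) v`.  The letters of `w` are
labelled relative to the twist `θ - z` for `Fermion.g` and `θ + z` for `Fermion.q`. -/
abbrev FormalState : Type := (ℤ × List Mode) →₀ ℂ

/-- Formal states whose coefficients depend polynomially on the length. -/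
abbrev FormalFamily : Type := (ℤ × List Mode) →₀ Polynomial ℂ

/-- The member of a family at the length `z`. -/
noncomputable def FormalFamily.at (f : FormalFamily) (z : ℂ) : FormalState :=
  f.mapRange (fun p => p.eval z) Polynomial.eval_zero

/-- Multiplication of formal states by a generator from the left. -/
noncomputable def FormalState.mul (m : Mode) : FormalState →ₗ[ℂ] FormalState :=
  Finsupp.lmapDomain ℂ ℂ fun x => (x.1, m :: x.2)

section Continuation

variable {V : Type*} [AddCommGroup V] [Module ℂ V]

/-- The products of integral length `N`:
`𝓖_{θ-N} ⋯ 𝓖_{θ-2} 𝓖_{θ-1}` for `g`, and `𝓠_{-θ-N+1} ⋯ 𝓠_{-θ-1} 𝓠_{-θ}` for `q`. -/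
def modeProduct (ρ : Mode → Module.End ℂ V) : Fermion → ℕ → Module.End ℂ V
  | _, 0 => 1
  | .g, N + 1 => ρ (.G (-(N + 1))) * modeProduct ρ .g N
  | .q, N + 1 => ρ (.Q (-N)) * modeProduct ρ .q N

/-- The value in `V` of a formal state when the length is the integer `N`
(meaningful when all the lengths `N + k` that occur are non-negative). -/
noncomputable def evalAt (s : Fermion) (ρ : Mode → Module.End ℂ V) (v : V) (N : ℤ) :
    FormalState →ₗ[ℂ] V :=
  Finsupp.linearCombination ℂ fun x : ℤ × List Mode =>
    wordOp (rebase (s.sign * N) ρ) x.2 (modeProduct ρ s (N + x.1).toNat v)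

/-- A relation, with coefficients polynomial in the length, that holds in `V` for the actual
products of modes at all sufficiently large integral lengths. -/
def IsIntegralIdentity (s : Fermion) (ρ : Mode → Module.End ℂ V) (v : V)
    (f : FormalFamily) : Prop :=
  ∃ K : ℤ, ∀ N : ℤ, K ≤ N → evalAt s ρ v N (f.at N) = 0

/-- The relations at complex length `z`: the continuation to `z` of all the integral identities
and, if `z` is an integer, all the relations that hold in `V` between the actual products of
modes (so that there is a module map `A_θ v → ContinuedSpace` which takes the products of modes
to the continued products of the same non-negative integral length). -/
noncomputable def continuedRelations (s : Fermion) (ρ : Mode → Module.End ℂ V) (v : V) (z : ℂ) :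
    Submodule ℂ FormalState :=
  Submodule.span ℂ
    ({r | ∃ f : FormalFamily, IsIntegralIdentity s ρ v f ∧ r = f.at z} ∪
     {r | ∃ n : ℤ, z = n ∧ (∀ x ∈ r.support, 0 ≤ n + x.1) ∧ evalAt s ρ v n r = 0})

theorem evalAt_mul (s : Fermion) (ρ : Mode → Module.End ℂ V) (v : V) (N : ℤ) (m : Mode)
    (r : FormalState) :
    evalAt s ρ v N (FormalState.mul m r) = rebase (s.sign * N) ρ m (evalAt s ρ v N r) := by
  induction r using Finsupp.induction_linear with
  | zero => simp
  | add a b ha hb => simp only [map_add, ha, hb]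
  | single x a => simp [evalAt, FormalState.mul, wordOp]

theorem continuedRelations_mul (s : Fermion) (ρ : Mode → Module.End ℂ V) (v : V) (z : ℂ)
    (m : Mode) :
    continuedRelations s ρ v z ≤ (continuedRelations s ρ v z).comap (FormalState.mul m) := by
  have key : ∀ (f : FormalFamily) (y : ℂ),
      FormalFamily.at (f.mapDomain fun x : ℤ × List Mode => (x.1, m :: x.2)) y =
        FormalState.mul m (f.at y) := by
    intro f y
    have hm : Function.Injective fun x : ℤ × List Mode => (x.1, m :: x.2) := by
      rintro ⟨a, b⟩ ⟨c, d⟩ h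
      simpa using h
    exact (Finsupp.mapDomain_mapRange _ f (fun p : Polynomial ℂ => p.eval y)
      Polynomial.eval_zero (fun _ _ => Polynomial.eval_add)).symm
  refine Submodule.span_le.2 ?_
  rintro r (⟨f, ⟨K, hf⟩, rfl⟩ | ⟨n, hz, hsupp, hr⟩)
  · refine Submodule.subset_span (Or.inl ⟨_, ⟨K, fun N hN => ?_⟩, (key f z).symm⟩)
    rw [key, evalAt_mul, hf N hN, map_zero]
  · refine Submodule.subset_span (Or.inr ⟨n, hz, fun x hx => ?_, ?_⟩)
    · classical
      obtain ⟨y, hy, rfl⟩ := Finset.mem_image.1 (Finsupp.mapDomain_support hx)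
      exact hsupp y hy
    · rw [evalAt_mul, hr, map_zero]

/-- The space of continued states at length `z`. -/
abbrev ContinuedSpace (s : Fermion) (ρ : Mode → Module.End ℂ V) (v : V) (z : ℂ) : Type :=
  FormalState ⧸ continuedRelations s ρ v z

/-- The generators acting on continued states. -/
noncomputable def continuedModes (s : Fermion) (ρ : Mode → Module.End ℂ V) (v : V) (z : ℂ) :
    Mode → Module.End ℂ (ContinuedSpace s ρ v z) := fun m =>
  (continuedRelations s ρ v z).mapQ (continuedRelations s ρ v z) (FormalState.mul m)
    (continuedRelations_mul s ρ v z m)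

/-- The continued product of length `z` applied to `v`. -/
noncomputable def continuedState (s : Fermion) (ρ : Mode → Module.End ℂ V) (v : V) (z : ℂ) :
    ContinuedSpace s ρ v z :=
  (continuedRelations s ρ v z).mkQ (Finsupp.single (0, []) 1)

/-- The state `g(θ', θ - 1) v`; the length of `g(a, b)` is `b - a + 1`. -/
noncomputable def gState (ρ : Mode → Module.End ℂ V) (θ' θ : ℂ) (v : V) :
    ContinuedSpace .g ρ v (θ - θ') :=
  continuedState .g ρ v (θ - θ')

/-- The generators of `A_{θ'}`, labelled relative to `θ'`, on the module of `g(θ', θ - 1) v`. -/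
noncomputable def gModes (ρ : Mode → Module.End ℂ V) (θ' θ : ℂ) (v : V) :
    Mode → Module.End ℂ (ContinuedSpace .g ρ v (θ - θ')) :=
  continuedModes .g ρ v (θ - θ')

/-- The state `q(-θ', -θ) v`; the length of `q(a, b)` is `b - a + 1`. -/
noncomputable def qState (ρ : Mode → Module.End ℂ V) (θ' θ : ℂ) (v : V) :
    ContinuedSpace .q ρ v (θ' - θ + 1) :=
  continuedState .q ρ v (θ' - θ + 1)

/-- The generators of `A_{θ'}`, labelled relative to `θ' + 1`, on the module of
`q(-θ', -θ) v`. -/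
noncomputable def qModes (ρ : Mode → Module.End ℂ V) (θ' θ : ℂ) (v : V) :
    Mode → Module.End ℂ (ContinuedSpace .q ρ v (θ' - θ + 1)) :=
  continuedModes .q ρ v (θ' - θ + 1)

end Continuation

/-- The factor `Λ(x, h, ℓ, t) = 2 (ℓ + x h - (x² + x) / t)`. -/
noncomputable def Lam (x h ℓ t : ℂ) : ℂ := 2 * (ℓ + x * h - (x ^ 2 + x) / t)

/-! ### Integral lengths: one mode at a time. -/

section Flow

variable {V : Type*} [AddCommGroup V] [Module ℂ V]

/-! Applying 𝓖_{θ-1} to a massive highest-weight vector of twist θ gives one of twist θ - 1, and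
𝓠_{-θ} gives one of twist θ + 1. Iterating, the product of length N has parameters that are
polynomials in N of degree at most two (`IsMassiveHW.flow`), and undoing its last mode by the
conjugate mode multiplies the product of length N - 1 by Λ. The highest-weight conditions, the Λ
identity and the commutation relations are thus relations with coefficients polynomial in N, so they
hold at every complex length (`sum_shiftedState_eq_zero`). A zero of Λ gives the extra annihilation
condition; conversely, on a non-zero vector the topological 𝓛_0 condition forces Λ = 0.

The real issue is that the relations might collapse the whole quotient. If one product of modes
vanishes, so do all longer ones, and the continued state is zero. If none vanishes, there is a
linear functional on formal states that kills all relations and equals 1 on the continued state. On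
a symbol it records the coefficient, after j further modes, along the product of length N + j. This
coefficient exists because 𝓖² = 𝓠² = 0 leaves, up to order, only one creation word of extremal
weight, and straightening keeps coefficients polynomial in N
(`IsHWFamily.exists_eval_smul_extremalWord`). Polynomiality lets the functional be evaluated at
complex z: a relation valid for all large N gives a polynomial with infinitely many zeros. The
freedom in j handles the actual relations imposed at a negative integral length. -/

theorem rebase_rebase (i j : ℤ) (ρ : Mode → Module.End ℂ V) :
    rebase i (rebase j ρ) = rebase (i + j) ρ := by
  funext m
  cases m <;> simp only [rebase] <;> congr 2 <;> ring

theorem rebase_zero (ρ : Mode → Module.End ℂ V) : rebase 0 ρ = ρ := by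
  funext m
  cases m <;> simp [rebase]

theorem IsN2Module.rebase {t θ : ℂ} {ρ : Mode → Module.End ℂ V} (hρ : IsN2Module t θ ρ) (j : ℤ) :
    IsN2Module t (θ + j) (rebase j ρ) where
  LL := hρ.LL
  HH := hρ.HH
  LG m n := by
    have := hρ.LG m (n + j)
    simp only [_root_.rebase]
    rw [this, add_assoc m n j]; push_cast; congr 1; ring
  HG m n := by
    have := hρ.HG m (n + j)
    simp only [_root_.rebase]
    rw [this, add_assoc m n j]
  LQ m n := by
    have := hρ.LQ m (n - j)
    simp only [_root_.rebase]
    rw [this, add_sub_assoc m n j]; push_cast; congr 1; ring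
  HQ m n := by
    have := hρ.HQ m (n - j)
    simp only [_root_.rebase]
    rw [this, add_sub_assoc m n j]
  LH := hρ.LH
  GQ m n := by
    have := hρ.GQ (m + j) (n - j)
    simp only [_root_.rebase]
    rw [this, show m + j + (n - j) = m + n by ring]; push_cast
    congr 2
    · congr 1; ring
    · congr 1; ring
  GG m n := hρ.GG _ _
  QQ m n := hρ.QQ _ _

theorem IsN2Module.G_mul_self {t θ : ℂ} {ρ : Mode → Module.End ℂ V} (hρ : IsN2Module t θ ρ)
    (m : ℤ) : ρ (.G m) * ρ (.G m) = 0 := by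
  simpa [← two_smul ℂ] using hρ.GG m m

theorem IsN2Module.Q_mul_self {t θ : ℂ} {ρ : Mode → Module.End ℂ V} (hρ : IsN2Module t θ ρ)
    (m : ℤ) : ρ (.Q m) * ρ (.Q m) = 0 := by
  simpa [← two_smul ℂ] using hρ.QQ m m

theorem sub_centralCharge_div {t : ℂ} (ht : t ≠ 0) : centralCharge t / 3 = 1 - 2 / t := by
  unfold centralCharge
  field_simp

theorem IsMassiveHW.H_zero_apply {t θ h ℓ : ℂ} {ρ : Mode → Module.End ℂ V} {v : V}
    (hv : IsMassiveHW t θ ρ h ℓ v) : ρ (.H 0) v = (h - centralCharge t / 3 * θ) • v := by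
  rw [sub_smul, ← hv.H_zero, add_sub_cancel_right]

theorem IsMassiveHW.L_zero_apply {t θ h ℓ : ℂ} {ρ : Mode → Module.End ℂ V} {v : V}
    (hv : IsMassiveHW t θ ρ h ℓ v) :
    ρ (.L 0) v = (ℓ - θ * h + centralCharge t / 6 * (θ ^ 2 - θ)) • v := by
  have := hv.L_zero
  rw [hv.H_zero_apply, smul_smul, add_assoc, ← add_smul] at this
  rw [eq_sub_of_add_eq this, ← sub_smul]
  congr 1; ring

/-- Since 𝓖_θ kills `v`, only the anticommutator contributes. This and the next lemma are the cases
x = 0 and x = -1 of Λ, from which the general factor follows along the flow. -/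
theorem IsMassiveHW.G_zero_Q_zero {t θ h ℓ : ℂ} {ρ : Mode → Module.End ℂ V} {v : V}
    (hρ : IsN2Module t θ ρ) (hv : IsMassiveHW t θ ρ h ℓ v) :
    ρ (.G 0) (ρ (.Q 0) v) = (2 * ℓ) • v := by
  have := LinearMap.congr_fun (hρ.GQ 0 0) v
  simp [hv.G_nonneg, hv.L_zero_apply, hv.H_zero_apply, smul_smul, ← add_smul] at this
  rw [this]; congr 1; ring

theorem IsMassiveHW.Q_one_G_neg_one {t θ h ℓ : ℂ} {ρ : Mode → Module.End ℂ V} {v : V}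
    (hρ : IsN2Module t θ ρ) (hv : IsMassiveHW t θ ρ h ℓ v) :
    ρ (.Q 1) (ρ (.G (-1)) v) = (2 * (ℓ - h)) • v := by
  have := LinearMap.congr_fun (hρ.GQ (-1) 1) v
  simp [hv.Q_pos, hv.L_zero_apply, hv.H_zero_apply, smul_smul, ← sub_smul, ← add_smul] at this
  rw [this]; congr 1; ring

/-- Relative to the new twist, the required 𝓖 conditions include 𝓖_{θ-1} itself, which holds because
it squares to zero, and the 𝓠 modes start one step higher, so their anticommutators with 𝓖_{θ-1}
only contain positive 𝓛 and 𝓗. The charge rises by 1 while the twist drops by 1, so `h` changes by 1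
- c/3 = 2/t. -/
theorem IsMassiveHW.G_neg_one {t θ h ℓ : ℂ} (ht : t ≠ 0) {ρ : Mode → Module.End ℂ V} {v : V}
    (hρ : IsN2Module t θ ρ) (hv : IsMassiveHW t θ ρ h ℓ v) :
    IsMassiveHW t (θ - 1) (rebase (-1) ρ) (h + 2 / t) (ℓ - h) (ρ (.G (-1)) v) where
  L_pos m hm := by
    have := LinearMap.congr_fun (hρ.LG m (-1)) v
    simpa [hv.L_pos m hm, hv.G_nonneg (m + -1) (by omega), rebase] using this
  H_pos m hm := by
    have := LinearMap.congr_fun (hρ.HG m (-1)) v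
    simpa [hv.H_pos m hm, hv.G_nonneg (m + -1) (by omega), rebase] using this
  Q_pos p hp := by
    have := LinearMap.congr_fun (hρ.GQ (-1) (p + 1)) v
    simpa [hv.Q_pos (p + 1) (by omega), hv.L_pos p hp, hv.H_pos p hp, rebase,
      show p ≠ 0 by omega] using this
  G_nonneg p hp := by
    rcases hp.eq_or_lt with rfl | hp
    · simpa [rebase] using LinearMap.congr_fun (hρ.G_mul_self (-1)) v
    · have := LinearMap.congr_fun (hρ.GG (p + -1) (-1)) v
      simpa [hv.G_nonneg (p + -1) (by omega), rebase] using this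
  H_zero := by
    have := LinearMap.congr_fun (hρ.HG 0 (-1)) v
    simp [hv.H_zero_apply, sub_eq_iff_eq_add] at this
    simp only [rebase, this, sub_centralCharge_div ht]
    module
  L_zero := by
    have h1 := LinearMap.congr_fun (hρ.HG 0 (-1)) v
    have h2 := LinearMap.congr_fun (hρ.LG 0 (-1)) v
    simp [hv.H_zero_apply, hv.L_zero_apply, sub_eq_iff_eq_add] at h1 h2
    simp only [rebase, h1, h2]
    module

theorem IsMassiveHW.Q_zero {t θ h ℓ : ℂ} (ht : t ≠ 0) {ρ : Mode → Module.End ℂ V} {v : V}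
    (hρ : IsN2Module t θ ρ) (hv : IsMassiveHW t θ ρ h ℓ v) :
    IsMassiveHW t (θ + 1) (rebase 1 ρ) (h - 2 / t) (ℓ + h - 2 / t) (ρ (.Q 0) v) where
  L_pos m hm := by
    have := LinearMap.congr_fun (hρ.LQ m 0) v
    simpa [hv.L_pos m hm, hv.Q_pos m hm, rebase] using this
  H_pos m hm := by
    have := LinearMap.congr_fun (hρ.HQ m 0) v
    simpa [hv.H_pos m hm, hv.Q_pos m hm, rebase] using this
  Q_pos p hp := by
    rcases hp.eq_or_lt with rfl | hp
    · simpa [rebase] using LinearMap.congr_fun (hρ.Q_mul_self 0) v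
    · have := LinearMap.congr_fun (hρ.QQ (p - 1) 0) v
      simpa [hv.Q_pos (p - 1) (by omega), rebase] using this
  G_nonneg p hp := by
    have := LinearMap.congr_fun (hρ.GQ (p + 1) 0) v
    simpa [hv.G_nonneg (p + 1) (by omega), hv.L_pos (p + 1) (by omega),
      hv.H_pos (p + 1) (by omega), rebase, show p + 1 ≠ 0 by omega] using this
  H_zero := by
    have := LinearMap.congr_fun (hρ.HQ 0 0) v
    simp [hv.H_zero_apply, sub_eq_iff_eq_add] at this
    simp only [rebase, this, sub_centralCharge_div ht]
    module
  L_zero := by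
    have h1 := LinearMap.congr_fun (hρ.HQ 0 0) v
    have h2 := LinearMap.congr_fun (hρ.LQ 0 0) v
    simp [hv.H_zero_apply, hv.L_zero_apply, sub_eq_iff_eq_add] at h1 h2
    have h3 : centralCharge t / 6 = (1 - 2 / t) / 2 := by rw [← sub_centralCharge_div ht]; ring
    simp only [rebase, h1, h2, sub_centralCharge_div ht, h3]
    module

/-- The products of modes are generalized massive highest-weight vectors. -/
theorem IsMassiveHW.flow {t θ h ℓ : ℂ} (ht : t ≠ 0) {ρ : Mode → Module.End ℂ V} {v : V}
    (hρ : IsN2Module t θ ρ) (hv : IsMassiveHW t θ ρ h ℓ v) (s : Fermion) (N : ℕ) :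
    IsMassiveHW t (θ + s.sign * N) (rebase (s.sign * N) ρ) (h - 2 / t * (s.sign * N))
      (ℓ + s.sign * N * (h - 1 / t * (s.sign * N + 1))) (modeProduct ρ s N v) := by
  induction N with
  | zero => simpa [modeProduct, rebase_zero] using hv
  | succ N ih =>
    cases s with
    | g =>
      have := ih.G_neg_one ht (by simpa using hρ.rebase (Fermion.g.sign * N))
      rw [rebase_rebase] at this
      convert this using 1
      · simp [Fermion.sign]; ring
      · simp [Fermion.sign]
      · simp [Fermion.sign]; ring
      · simp [Fermion.sign]; ring
      · simp [modeProduct, Fermion.sign, rebase]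
    | q =>
      have := ih.Q_zero ht (by simpa using hρ.rebase (Fermion.q.sign * N))
      rw [rebase_rebase] at this
      convert this using 1
      · simp [Fermion.sign]; ring
      · simp [Fermion.sign]; congr 1; ring
      · simp [Fermion.sign]; ring
      · simp [Fermion.sign]; ring
      · simp [modeProduct, Fermion.sign, rebase]

/-- `𝓠_{-θ+N} 𝓖_{θ-N} = Λ` on the product of `N - 1` modes `𝓖`. -/
theorem IsMassiveHW.Q_modeProduct_succ {t θ h ℓ : ℂ} (ht : t ≠ 0) {ρ : Mode → Module.End ℂ V}
    {v : V} (hρ : IsN2Module t θ ρ) (hv : IsMassiveHW t θ ρ h ℓ v) (N : ℕ) :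
    ρ (.Q (N + 1)) (modeProduct ρ .g (N + 1) v) =
      Lam (-(N + 1)) h ℓ t • modeProduct ρ .g N v := by
  have := (hv.flow ht hρ .g N).Q_one_G_neg_one
    (by simpa using hρ.rebase (Fermion.g.sign * N))
  simp only [rebase, Fermion.sign] at this
  convert this using 2
  · congr 2; ring
  · simp [modeProduct]
  · simp [Lam]; field_simp; ring

/-- `𝓖_{θ+N-1} 𝓠_{-θ-N+1} = Λ` on the product of `N - 1` modes `𝓠`. -/
theorem IsMassiveHW.G_modeProduct_succ {t θ h ℓ : ℂ} (ht : t ≠ 0) {ρ : Mode → Module.End ℂ V}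
    {v : V} (hρ : IsN2Module t θ ρ) (hv : IsMassiveHW t θ ρ h ℓ v) (N : ℕ) :
    ρ (.G N) (modeProduct ρ .q (N + 1) v) = Lam N h ℓ t • modeProduct ρ .q N v := by
  have := (hv.flow ht hρ .q N).G_zero_Q_zero
    (by simpa using hρ.rebase (Fermion.q.sign * N))
  simp only [rebase, Fermion.sign] at this
  convert this using 2
  · congr 2; ring
  · simp [modeProduct]
  · simp [Lam]; field_simp; ring

/-- A massive highest-weight vector with `ℓ = 0` annihilated by `𝓠_{-θ}` is topological. -/
theorem IsMassiveHW.isTopologicalHW {t θ h ℓ : ℂ} {ρ : Mode → Module.End ℂ V} {v : V}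
    (hv : IsMassiveHW t θ ρ h ℓ v) (hℓ : ℓ = 0) (hQ : ρ (.Q 0) v = 0) :
    IsTopologicalHW t θ ρ h v where
  L_pos := hv.L_pos
  H_pos := hv.H_pos
  Q_nonneg p hp := by
    rcases hp.eq_or_lt with rfl | hp
    · exact hQ
    · exact hv.Q_pos p hp
  G_nonneg := hv.G_nonneg
  H_zero := hv.H_zero
  L_zero := by rw [hv.L_zero, hℓ, zero_smul]

/-- A massive highest-weight vector with twist `θ + 1` and `ℓ = h` annihilated by `𝓖_θ` is
topological with twist `θ`. -/
theorem IsMassiveHW.isTopologicalHW_rebase {t θ h ℓ : ℂ} (ht : t ≠ 0)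
    {ρ : Mode → Module.End ℂ V} {v : V}
    (hv : IsMassiveHW t (θ + 1) ρ h ℓ v) (hℓ : ℓ = h) (hG : ρ (.G (-1)) v = 0) :
    IsTopologicalHW t θ (rebase (-1) ρ) (h + 2 / t - 1) v where
  L_pos := hv.L_pos
  H_pos := hv.H_pos
  Q_nonneg p hp := hv.Q_pos _ (by omega)
  G_nonneg p hp := by
    rcases hp.eq_or_lt with rfl | hp
    · exact hG
    · exact hv.G_nonneg _ (by omega)
  H_zero := by
    simp only [rebase, hv.H_zero_apply, sub_centralCharge_div ht]
    module
  L_zero := by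
    simp only [rebase, hv.H_zero_apply, hv.L_zero_apply, hℓ]
    module

end Flow

/-! ### Continuation of polynomial identities to complex length. -/

section Transfer

open Polynomial

variable {V : Type*} [AddCommGroup V] [Module ℂ V]

theorem FormalFamily.at_single (x : ℤ × List Mode) (p : ℂ[X]) (z : ℂ) :
    FormalFamily.at (Finsupp.single x p) z = Finsupp.single x (p.eval z) :=
  Finsupp.mapRange_single

theorem FormalFamily.at_sum_map {α : Type*} (l : List α) (f : α → FormalFamily) (z : ℂ) :
    FormalFamily.at (l.map f).sum z = (l.map fun x => (f x).at z).sum := by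
  induction l with
  | nil => exact Finsupp.mapRange_zero
  | cons a l ih =>
    rw [List.map_cons, List.sum_cons, List.map_cons, List.sum_cons, ← ih]
    exact Finsupp.mapRange_add (fun _ _ => eval_add) _ _

theorem wordOp_append (ρ : Mode → Module.End ℂ V) (u w : List Mode) :
    wordOp ρ (u ++ w) = wordOp ρ u * wordOp ρ w := by
  simp [wordOp]

theorem wordOp_cons (ρ : Mode → Module.End ℂ V) (m : Mode) (w : List Mode) :
    wordOp ρ (m :: w) = ρ m * wordOp ρ w := by
  simp [wordOp]

theorem evalAt_single (s : Fermion) (ρ : Mode → Module.End ℂ V) (v : V) (N : ℤ)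
    (x : ℤ × List Mode) (a : ℂ) :
    evalAt s ρ v N (Finsupp.single x a) =
      a • wordOp (rebase (s.sign * N) ρ) x.2 (modeProduct ρ s (N + x.1).toNat v) := by
  simp [evalAt]

/-- The continued product of length `z + k` applied to `v`, in the space of continued states at
length `z`. -/
noncomputable def shiftedState (s : Fermion) (ρ : Mode → Module.End ℂ V) (v : V) (z : ℂ) (k : ℤ) :
    ContinuedSpace s ρ v z :=
  (continuedRelations s ρ v z).mkQ (Finsupp.single (k, []) 1)

/-- Turns formal symbols into operators acting on shifted products, so that membership in the
relations can be read as an equation in the module of continued states. -/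
theorem mkQ_single (s : Fermion) (ρ : Mode → Module.End ℂ V) (v : V) (z : ℂ)
    (x : ℤ × List Mode) (a : ℂ) :
    (continuedRelations s ρ v z).mkQ (Finsupp.single x a) =
      a • wordOp (continuedModes s ρ v z) x.2 (shiftedState s ρ v z x.1) := by
  obtain ⟨k, w⟩ := x
  induction w with
  | nil => simp [wordOp, shiftedState, ← Submodule.Quotient.mk_smul]
  | cons m w ih =>
    rw [wordOp_cons, Module.End.mul_apply, ← map_smul, ← ih]
    simp [continuedModes, FormalState.mul]

/-- An identity between products of modes with coefficients polynomial in the length continues to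
all complex lengths. -/
theorem sum_shiftedState_eq_zero (s : Fermion) (ρ : Mode → Module.End ℂ V) (v : V) (z : ℂ)
    (l : List (ℂ[X] × ℤ × List Mode)) (K : ℤ)
    (h : ∀ N : ℤ, K ≤ N → (l.map fun x => x.1.eval (N : ℂ) •
      wordOp (rebase (s.sign * N) ρ) x.2.2 (modeProduct ρ s (N + x.2.1).toNat v)).sum = 0) :
    (l.map fun x => x.1.eval z •
      wordOp (continuedModes s ρ v z) x.2.2 (shiftedState s ρ v z x.2.1)).sum = 0 := by
  have hf : (continuedRelations s ρ v z).mkQ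
      (FormalFamily.at (l.map fun x => Finsupp.single x.2 x.1).sum z) = 0 := by
    rw [Submodule.mkQ_apply, Submodule.Quotient.mk_eq_zero]
    refine Submodule.subset_span (Or.inl ⟨_, ⟨K, fun N hN => ?_⟩, rfl⟩)
    rw [FormalFamily.at_sum_map, map_list_sum, List.map_map, ← h N hN]
    simp only [Function.comp_def, FormalFamily.at_single, evalAt_single]
  rw [FormalFamily.at_sum_map, map_list_sum, List.map_map] at hf
  simpa only [Function.comp_def, FormalFamily.at_single, mkQ_single] using hf

theorem sum_smul_wordOp_apply (ρ : Mode → Module.End ℂ V) (l : List (ℂ[X] × List Mode)) (z : ℂ)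
    (u : V) : (l.map fun x => x.1.eval z • wordOp ρ x.2).sum u =
      (l.map fun x => x.1.eval z • wordOp ρ x.2 u).sum := by
  simpa [Function.comp_def] using
    map_list_sum (LinearMap.applyₗ u) (l.map fun x => x.1.eval z • wordOp ρ x.2)

/-- An operator identity with coefficients polynomial in the twist continues to all complex
lengths. -/
theorem sum_wordOp_continuedModes_eq_zero (s : Fermion) (ρ : Mode → Module.End ℂ V) (v : V) (z : ℂ)
    (l : List (ℂ[X] × List Mode))
    (h : ∀ N : ℤ, (l.map fun x => x.1.eval (N : ℂ) •
      wordOp (rebase (s.sign * N) ρ) x.2).sum = 0) :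
    (l.map fun x => x.1.eval z • wordOp (continuedModes s ρ v z) x.2).sum = 0 := by
  -- The symbols span the quotient, so it suffices to apply the identity to each of them; there it
  -- becomes a relation between concatenated words. The bound 0 is arbitrary.
  refine Submodule.linearMap_qext _ (Finsupp.lhom_ext' fun x => LinearMap.ext_ring ?_)
  have := sum_shiftedState_eq_zero s ρ v z (l.map fun y => (y.1, x.1, y.2 ++ x.2)) 0
    fun N _ => by
      have := LinearMap.congr_fun (h N)
        (wordOp (rebase (s.sign * N) ρ) x.2 (modeProduct ρ s (N + x.1).toNat v))
      rw [sum_smul_wordOp_apply] at this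
      simpa [Function.comp_def, wordOp_append] using this
  simp only [LinearMap.comp_apply, Finsupp.lsingle_apply, mkQ_single, one_smul,
    LinearMap.zero_apply]
  rw [sum_smul_wordOp_apply]
  simpa [Function.comp_def, wordOp_append] using this

theorem isN2Module_continuedModes {t θ : ℂ} {ρ : Mode → Module.End ℂ V} (hρ : IsN2Module t θ ρ)
    (s : Fermion) (v : V) (z : ℂ) :
    IsN2Module t (θ + s.sign * z) (continuedModes s ρ v z) := by
  have hN : ∀ N : ℤ, IsN2Module t (θ + s.sign * N) (rebase (s.sign * N) ρ) := fun N => by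
    simpa using hρ.rebase (s.sign * N)
  have key := sum_wordOp_continuedModes_eq_zero s ρ v z
  refine ⟨fun m n => ?_, fun m n => ?_, fun m n => ?_, fun m n => ?_, fun m n => ?_,
    fun m n => ?_, fun m n => ?_, fun m n => ?_, fun m n => ?_, fun m n => ?_⟩ <;>
    rw [← sub_eq_zero]
  -- The twist at length N is the polynomial θ ± N, so each structure relation is a polynomial
  -- family. Each `refine` leaves two rewriting goals, hence the odd positions.
  on_goal 1 => refine Eq.trans ?_ (key [(1, [.L m, .L n]), (-1, [.L n, .L m]),
      (-C ((m : ℂ) - n), [.L (m + n)])]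
      fun N => Eq.trans ?_ (sub_eq_zero.2 ((hN N).LL m n)))
  on_goal 3 => refine Eq.trans ?_ (key [(1, [.H m, .H n]), (-1, [.H n, .H m]),
      (-C (if m + n = 0 then centralCharge t / 3 * m else 0), [])]
      fun N => Eq.trans ?_ (sub_eq_zero.2 ((hN N).HH m n)))
  on_goal 5 => refine Eq.trans ?_ (key [(1, [.L m, .G n]), (-1, [.G n, .L m]),
      (-(C ((m : ℂ) - (θ + n)) - C (s.sign : ℂ) * X), [.G (m + n)])]
      fun N => Eq.trans ?_ (sub_eq_zero.2 ((hN N).LG m n)))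
  on_goal 7 => refine Eq.trans ?_ (key [(1, [.H m, .G n]), (-1, [.G n, .H m]),
      (-1, [.G (m + n)])]
      fun N => Eq.trans ?_ (sub_eq_zero.2 ((hN N).HG m n)))
  on_goal 9 => refine Eq.trans ?_ (key [(1, [.L m, .Q n]), (-1, [.Q n, .L m]),
      (C (-θ + n) - C (s.sign : ℂ) * X, [.Q (m + n)])]
      fun N => Eq.trans ?_ (sub_eq_zero.2 ((hN N).LQ m n)))
  on_goal 11 => refine Eq.trans ?_ (key [(1, [.H m, .Q n]), (-1, [.Q n, .H m]),
      (1, [.Q (m + n)])]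
      fun N => Eq.trans ?_ (sub_eq_zero.2 ((hN N).HQ m n)))
  on_goal 13 => refine Eq.trans ?_ (key [(1, [.L m, .H n]), (-1, [.H n, .L m]),
      (C (n : ℂ), [.H (m + n)]),
      (-C (if m + n = 0 then centralCharge t / 6 * ((m : ℂ) ^ 2 + m) else 0), [])]
      fun N => Eq.trans ?_ (sub_eq_zero.2 ((hN N).LH m n)))
  on_goal 15 => refine Eq.trans ?_ (key [(1, [.G m, .Q n]), (1, [.Q n, .G m]),
      (-C 2, [.L (m + n)]),
      (C 2 * (C (-θ + n) - C (s.sign : ℂ) * X), [.H (m + n)]),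
      (-(if m + n = 0 then C (centralCharge t / 3) * ((C (θ + m) + C (s.sign : ℂ) * X) ^ 2 +
          (C (θ + m) + C (s.sign : ℂ) * X)) else 0), [])]
      fun N => Eq.trans ?_ (sub_eq_zero.2 ((hN N).GQ m n)))
  on_goal 17 => refine Eq.trans ?_ (key [(1, [.G m, .G n]), (1, [.G n, .G m])]
      fun N => Eq.trans ?_ (sub_eq_zero.2 ((hN N).GG m n)))
  on_goal 19 => refine Eq.trans ?_ (key [(1, [.Q m, .Q n]), (1, [.Q n, .Q m])]
      fun N => Eq.trans ?_ (sub_eq_zero.2 ((hN N).QQ m n)))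
  all_goals
    simp only [wordOp, List.map, List.sum_cons, List.prod_cons, List.sum_nil, List.prod_nil,
      eval_neg, eval_one, eval_C, eval_X, eval_sub, eval_mul, eval_add, eval_pow,
      apply_ite (eval _), eval_zero, mul_one]
    try split_ifs
    all_goals module

end Transfer

/-! ### Highest-weight conditions on the continued state. -/

section ContinuedHW

open Polynomial

variable {V : Type*} [AddCommGroup V] [Module ℂ V]

theorem shiftedState_zero (s : Fermion) (ρ : Mode → Module.End ℂ V) (v : V) (z : ℂ) :
    shiftedState s ρ v z 0 = continuedState s ρ v z := rfl

theorem continuedModes_continuedState_eq_zero {s : Fermion} {ρ : Mode → Module.End ℂ V} {v : V}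
    {m : Mode} (h : ∀ N : ℕ, rebase (s.sign * N) ρ m (modeProduct ρ s N v) = 0) (z : ℂ) :
    continuedModes s ρ v z m (continuedState s ρ v z) = 0 := by
  have := sum_shiftedState_eq_zero s ρ v z [(1, 0, [m])] 0 fun N hN => by
    lift N to ℕ using hN
    simpa [wordOp] using h N
  simpa [wordOp, shiftedState_zero] using this

theorem IsMassiveHW.continuedState {t θ h ℓ : ℂ} (ht : t ≠ 0) {ρ : Mode → Module.End ℂ V} {v : V}
    (hρ : IsN2Module t θ ρ) (hv : IsMassiveHW t θ ρ h ℓ v) (s : Fermion) (z : ℂ) :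
    IsMassiveHW t (θ + s.sign * z) (continuedModes s ρ v z) (h - 2 / t * (s.sign * z))
      (ℓ + s.sign * z * (h - 1 / t * (s.sign * z + 1))) (continuedState s ρ v z) where
  L_pos m hm := continuedModes_continuedState_eq_zero (fun N => (hv.flow ht hρ s N).L_pos m hm) z
  H_pos m hm := continuedModes_continuedState_eq_zero (fun N => (hv.flow ht hρ s N).H_pos m hm) z
  Q_pos m hm := continuedModes_continuedState_eq_zero (fun N => (hv.flow ht hρ s N).Q_pos m hm) z
  G_nonneg m hm :=
    continuedModes_continuedState_eq_zero (fun N => (hv.flow ht hρ s N).G_nonneg m hm) z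
  H_zero := by
    have := sum_shiftedState_eq_zero s ρ v z [(1, 0, [.H 0]),
      (C (centralCharge t / 3) * (C θ + C (s.sign : ℂ) * X), 0, []),
      (-(C h - C (2 / t) * (C (s.sign : ℂ) * X)), 0, [])] 0 fun N hN => by
        lift N to ℕ using hN
        have := sub_eq_zero.2 (hv.flow ht hρ s N).H_zero
        rw [← this]
        simp [wordOp]
        module
    rw [← sub_eq_zero, ← this]
    simp only [wordOp, List.map, List.sum_cons, List.prod_cons, List.sum_nil, List.prod_nil,
      eval_neg, eval_one, eval_C, eval_X, eval_sub, eval_mul, eval_add, mul_one,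
      Module.End.one_apply, shiftedState_zero]
    module
  L_zero := by
    have := sum_shiftedState_eq_zero s ρ v z [(1, 0, [.L 0]),
      (C θ + C (s.sign : ℂ) * X, 0, [.H 0]),
      (C (centralCharge t / 6) * ((C θ + C (s.sign : ℂ) * X) ^ 2 + (C θ + C (s.sign : ℂ) * X)),
        0, []),
      (-(C ℓ + C (s.sign : ℂ) * X * (C h - C (1 / t) * (C (s.sign : ℂ) * X + 1))), 0, [])] 0
      fun N hN => by
        lift N to ℕ using hN
        have := sub_eq_zero.2 (hv.flow ht hρ s N).L_zero
        rw [← this]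
        simp [wordOp]
        module
    rw [← sub_eq_zero, ← this]
    simp only [wordOp, List.map, List.sum_cons, List.prod_cons, List.sum_nil, List.prod_nil,
      eval_neg, eval_one, eval_C, eval_X, eval_sub, eval_mul, eval_add, eval_pow, mul_one,
      Module.End.one_apply, shiftedState_zero]
    module

/-- Once one product vanishes all longer ones do, so the vanishing of the product is itself an
identity at all large lengths and gets continued. -/
theorem continuedState_eq_zero {s : Fermion} {ρ : Mode → Module.End ℂ V} {v : V} {N : ℕ}
    (hN : modeProduct ρ s N v = 0) (z : ℂ) : continuedState s ρ v z = 0 := by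
  have h : ∀ n : ℕ, modeProduct ρ s (N + n) v = 0 := fun n => by
    induction n with
    | zero => exact hN
    | succ n ih => cases s <;> simp [← add_assoc, modeProduct, ih]
  have := sum_shiftedState_eq_zero s ρ v z [(1, 0, [])] N fun M hM => by
    obtain ⟨n, rfl⟩ := Int.le.dest hM
    have h0 : ((N : ℤ) + n).toNat = N + n := by omega
    simp [wordOp, h0, h n]
  simpa [wordOp, shiftedState_zero] using this

theorem IsMassiveHW.continuedModes_Q_zero {t θ h ℓ : ℂ} (ht : t ≠ 0)
    {ρ : Mode → Module.End ℂ V} {v : V} (hρ : IsN2Module t θ ρ) (hv : IsMassiveHW t θ ρ h ℓ v)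
    (z : ℂ) : continuedModes .g ρ v z (.Q 0) (_root_.continuedState .g ρ v z) =
      Lam (-z) h ℓ t • shiftedState .g ρ v z (-1) := by
  have := sum_shiftedState_eq_zero .g ρ v z [(1, 0, [.Q 0]),
    -- The identity is used from length 1 on, because the product of length N - 1 occurs in it.
    (-(C 2 * (C ℓ + -X * C h - C (1 / t) * ((-X) ^ 2 + -X))), -1, [])] 1 fun N hN => by
      obtain ⟨n, rfl⟩ := Int.le.dest hN
      have := hv.Q_modeProduct_succ ht hρ n
      rw [Lam, ← sub_eq_zero] at this
      rw [← this]
      simp [wordOp, rebase, Fermion.sign, add_comm (1 : ℤ)]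
      module
  rw [← sub_eq_zero, ← this]
  simp only [wordOp, List.map, List.sum_cons, List.prod_cons, List.sum_nil, List.prod_nil,
    eval_neg, eval_one, eval_C, eval_X, eval_sub, eval_mul, eval_add, eval_pow, mul_one,
    Module.End.one_apply, shiftedState_zero, Lam]
  module

theorem IsMassiveHW.continuedModes_G_neg_one {t θ h ℓ : ℂ} (ht : t ≠ 0)
    {ρ : Mode → Module.End ℂ V} {v : V} (hρ : IsN2Module t θ ρ) (hv : IsMassiveHW t θ ρ h ℓ v)
    (z : ℂ) : continuedModes .q ρ v z (.G (-1)) (_root_.continuedState .q ρ v z) =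
      Lam (z - 1) h ℓ t • shiftedState .q ρ v z (-1) := by
  have := sum_shiftedState_eq_zero .q ρ v z [(1, 0, [.G (-1)]),
    (-(C 2 * (C ℓ + (X - 1) * C h - C (1 / t) * ((X - 1) ^ 2 + (X - 1)))), -1, [])] 1
    fun N hN => by
      obtain ⟨n, rfl⟩ := Int.le.dest hN
      have := hv.G_modeProduct_succ ht hρ n
      rw [Lam, ← sub_eq_zero] at this
      rw [← this]
      simp [wordOp, rebase, Fermion.sign, add_comm (1 : ℤ)]
      module
  rw [← sub_eq_zero, ← this]
  simp only [wordOp, List.map, List.sum_cons, List.prod_cons, List.sum_nil, List.prod_nil,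
    eval_neg, eval_one, eval_C, eval_X, eval_sub, eval_mul, eval_add, eval_pow, mul_one,
    Module.End.one_apply, shiftedState_zero, Lam]
  module

end ContinuedHW

/-! ### Combinatorics of words of extremal weight. -/

section ExtremalWords

/-- The charge and the sum of the labels of a generator. -/
def Mode.weight : Mode → ℤ × ℤ
  | .L n => (0, n)
  | .H n => (0, n)
  | .Q n => (-1, n)
  | .G n => (1, n)

/-- The weight of a word is the sum of the weights of its letters. -/
def wordWeight (w : List Mode) : ℤ × ℤ := (w.map Mode.weight).sum

/-- The word `𝓖_{θ-J} ⋯ 𝓖_{θ-1}`, resp. `𝓠_{-θ-J+1} ⋯ 𝓠_{-θ}`. -/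
def extremalWord : Fermion → ℕ → List Mode
  | _, 0 => []
  | .g, J + 1 => .G (-(J + 1)) :: extremalWord .g J
  | .q, J + 1 => .Q (-J) :: extremalWord .q J

/-- The generators that do not act by scalars on massive highest-weight vectors. -/
def Mode.IsCreation : Mode → Prop
  | .L n => n < 0
  | .H n => n < 0
  | .Q n => n ≤ 0
  | .G n => n < 0

theorem wordWeight_append (u w : List Mode) :
    wordWeight (u ++ w) = wordWeight u + wordWeight w := by
  simp [wordWeight]

theorem wordWeight_cons (m : Mode) (w : List Mode) :
    wordWeight (m :: w) = m.weight + wordWeight w := by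
  simp [wordWeight]

theorem List.Perm.wordWeight_eq {u w : List Mode} (h : u.Perm w) : wordWeight u = wordWeight w :=
  (h.map _).sum_eq

theorem two_mul_sum_range (k : ℕ) : 2 * ((List.range k).sum : ℤ) = k * (k - 1) := by
  induction k with
  | zero => simp
  | succ k ih =>
    rw [List.range_succ, List.sum_append, Nat.cast_add, mul_add, ih, List.sum_singleton]
    push_cast
    ring

theorem List.Nodup.perm_range_or_lt_sum {l : List ℕ} (hl : l.Nodup) :
    l.Perm (List.range l.length) ∨ (l.length : ℤ) * (l.length - 1) < 2 * (l.sum : ℤ) := by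
  induction hk : l.length generalizing l with
  | zero => left; simp [List.length_eq_zero_iff.1 hk]
  | succ k ih =>
    -- If all k + 1 distinct numbers are below k + 1, they fill the range. Otherwise some x ≥ k + 1
    -- can be removed, and it already exceeds the increment k between consecutive minimal sums.
    by_cases h : ∀ x ∈ l, x < k + 1
    · left
      exact (hl.subperm fun x hx => List.mem_range.2 (h x hx)).perm_of_length_le (by simp [hk])
    · right
      push Not at h
      obtain ⟨x, hx, hkx⟩ := h
      obtain ⟨u, w, rfl⟩ := List.append_of_mem hx
      have hp : (u ++ x :: w).Perm (x :: (u ++ w)) := List.perm_middle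
      have hs := hp.sum_eq
      rw [List.sum_cons] at hs
      have hlen : (u ++ w).length = k := by
        have := hp.length_eq
        simp only [List.length_cons] at this
        omega
      rw [hs]
      rw [Nat.cast_add, Nat.cast_add, Nat.cast_one]
      have hx' : (k : ℤ) + 1 ≤ x := by exact_mod_cast hkx
      rcases ih (List.nodup_cons.1 (hp.nodup_iff.1 hl)).2 hlen with h | h
      · have := two_mul_sum_range k
        rw [h.sum_eq]
        nlinarith
      · nlinarith

theorem List.Nodup.length_mul_le_sum {l : List ℕ} (hl : l.Nodup) :
    (l.length : ℤ) * (l.length - 1) ≤ 2 * (l.sum : ℤ) := by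
  rcases hl.perm_range_or_lt_sum with h | h
  · rw [h.sum_eq, two_mul_sum_range]
  · exact h.le

theorem extremalWord_g (J : ℕ) :
    extremalWord .g J = (List.range J).reverse.map fun n : ℕ => Mode.G (-((n : ℤ) + 1)) := by
  induction J with
  | zero => rfl
  | succ J ih => simp [extremalWord, ih, List.range_succ]

theorem extremalWord_q (J : ℕ) :
    extremalWord .q J = (List.range J).reverse.map fun n : ℕ => Mode.Q (-(n : ℤ)) := by
  induction J with
  | zero => rfl
  | succ J ih => simp [extremalWord, ih, List.range_succ]

theorem wordWeight_extremalWord_g (J : ℕ) :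
    (wordWeight (extremalWord .g J)).1 = J ∧
      2 * (wordWeight (extremalWord .g J)).2 = -(J * (J + 1)) := by
  induction J with
  | zero => simp [extremalWord, wordWeight]
  | succ J ih =>
    simp only [extremalWord, wordWeight_cons, Mode.weight, Prod.fst_add, Prod.snd_add, mul_add, ih]
    push_cast
    constructor <;> ring

theorem wordWeight_extremalWord_q (J : ℕ) :
    (wordWeight (extremalWord .q J)).1 = -J ∧
      2 * (wordWeight (extremalWord .q J)).2 = -(J * (J - 1)) := by
  induction J with
  | zero => simp [extremalWord, wordWeight]
  | succ J ih =>
    simp only [extremalWord, wordWeight_cons, Mode.weight, Prod.fst_add, Prod.snd_add, mul_add, ih]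
    push_cast
    constructor <;> ring

/-- The index `i` of a mode `𝓖_{θ-1-i}`. -/
def Mode.gIndex : Mode → Option ℕ
  | .G n => some (-n - 1).toNat
  | _ => none

/-- The index `i` of a mode `𝓠_{-θ-i}`. -/
def Mode.qIndex : Mode → Option ℕ
  | .Q n => some (-n).toNat
  | _ => none

/-- Letter by letter: 𝓖 of index i lowers the label sum by i + 1, 𝓠 of index i by i, and each 𝓛 or 𝓗
by at least 1. The total length minus the number of 𝓠 therefore bounds the remaining descent. -/
theorem wordWeight_le_of_isCreation {w : List Mode} (hw : ∀ a ∈ w, a.IsCreation) :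
    (wordWeight w).1 = (w.filterMap Mode.gIndex).length - (w.filterMap Mode.qIndex).length ∧
    (w.filterMap Mode.gIndex).length + (w.filterMap Mode.qIndex).length ≤ w.length ∧
    (wordWeight w).2 + (w.filterMap Mode.gIndex).sum + (w.filterMap Mode.qIndex).sum + w.length -
      (w.filterMap Mode.qIndex).length ≤ 0 := by
  induction w with
  | nil => simp [wordWeight]
  | cons a w ih =>
    obtain ⟨h1, h2, h3⟩ := ih fun b hb => hw b (List.mem_cons_of_mem _ hb)
    have ha := hw a List.mem_cons_self
    cases a <;> simp only [Mode.IsCreation] at ha <;>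
      simp only [wordWeight_cons, Mode.weight, Prod.fst_add, Prod.snd_add, Mode.gIndex,
        Mode.qIndex, List.filterMap_cons, List.length_cons, List.sum_cons, Nat.cast_add,
        Nat.cast_one] <;>
      omega

theorem eq_map_of_length_filterMap_gIndex {w : List Mode} (hw : ∀ a ∈ w, a.IsCreation)
    (h : w.length ≤ (w.filterMap Mode.gIndex).length) :
    w = (w.filterMap Mode.gIndex).map fun n : ℕ => Mode.G (-((n : ℤ) + 1)) := by
  induction w with
  | nil => rfl
  | cons a w ih =>
    have ha := hw a List.mem_cons_self
    have hle := List.length_filterMap_le Mode.gIndex w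
    cases a <;> simp only [Mode.IsCreation] at ha <;>
      simp only [Mode.gIndex, List.filterMap_cons, List.length_cons] at h ⊢
    case G n =>
      rw [List.map_cons, ← ih (fun b hb => hw b (List.mem_cons_of_mem _ hb)) (by omega)]
      congr 2; omega
    all_goals omega

theorem eq_map_of_length_filterMap_qIndex {w : List Mode} (hw : ∀ a ∈ w, a.IsCreation)
    (h : w.length ≤ (w.filterMap Mode.qIndex).length) :
    w = (w.filterMap Mode.qIndex).map fun n : ℕ => Mode.Q (-(n : ℤ)) := by
  induction w with
  | nil => rfl
  | cons a w ih =>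
    have ha := hw a List.mem_cons_self
    have hle := List.length_filterMap_le Mode.qIndex w
    cases a <;> simp only [Mode.IsCreation] at ha <;>
      simp only [Mode.qIndex, List.filterMap_cons, List.length_cons] at h ⊢
    case Q n =>
      rw [List.map_cons, ← ih (fun b hb => hw b (List.mem_cons_of_mem _ hb)) (by omega)]
      congr 2; omega
    all_goals omega

/-- A word of creation operators without repeated fermions is determined, up to the order of the
letters, by its weight if that weight is extremal. -/
theorem perm_extremalWord {s : Fermion} {J : ℕ} {w : List Mode} (hw : ∀ a ∈ w, a.IsCreation)
    (hG : w.Pairwise fun a b => ∀ n, a = .G n → b ≠ .G n)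
    (hQ : w.Pairwise fun a b => ∀ n, a = .Q n → b ≠ .Q n)
    (h : wordWeight w = wordWeight (extremalWord s J)) : w.Perm (extremalWord s J) := by
  have hcr : w.Pairwise fun a b => a.IsCreation ∧ b.IsCreation :=
    List.pairwise_of_forall_mem_list fun a ha b hb => ⟨hw a ha, hw b hb⟩
  have hA : (w.filterMap Mode.gIndex).Nodup := by
    refine List.pairwise_filterMap.2 ((hG.and hcr).imp ?_)
    rintro (_ | _ | _ | n) (_ | _ | _ | m) ⟨h, h'⟩ <;> simp_all [Mode.gIndex, Mode.IsCreation]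
    omega
  have hB : (w.filterMap Mode.qIndex).Nodup := by
    refine List.pairwise_filterMap.2 ((hQ.and hcr).imp ?_)
    rintro (_ | _ | n | _) (_ | _ | m | _) ⟨h, h'⟩ <;> simp_all [Mode.qIndex, Mode.IsCreation]
    omega
  obtain ⟨h1, h2, h3⟩ := wordWeight_le_of_isCreation hw
  have hAs := hA.perm_range_or_lt_sum
  have hBs := hB.perm_range_or_lt_sum
  have gA := eq_map_of_length_filterMap_gIndex hw
  have gB := eq_map_of_length_filterMap_qIndex hw
  generalize w.filterMap Mode.gIndex = A at *
  generalize w.filterMap Mode.qIndex = B at *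
  have hA' := hA.length_mul_le_sum
  have hB' := hB.length_mul_le_sum
  cases s with
  | g =>
    obtain ⟨e1, e2⟩ := wordWeight_extremalWord_g J
    rw [← h] at e1 e2
    have hk : (A.length : ℤ) = J + B.length := by omega
    -- Distinct indices push the label sum down to at most -|A|(|A| + 1)/2. With |A| = J + |B|, a
    -- single 𝓠 would take it below the extremal value -J(J + 1)/2.
    have hl : B.length = 0 := by
      by_contra hl
      have : (1 : ℤ) ≤ B.length := by omega
      rw [hk] at hA'
      nlinarith
    rw [hl] at hk h2 h3
    have hAJ : A.length = J := by omega
    rw [hAJ] at hAs gA hA' h2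
    rcases hAs with hAs | hAs
    -- The 𝓖 modes exhaust the label sum, so the length is at most J and no 𝓛 or 𝓗 occurs.
    · rw [gA (by nlinarith), extremalWord_g]
      exact (hAs.trans (List.reverse_perm _).symm).map _
    · nlinarith
  | q =>
    obtain ⟨e1, e2⟩ := wordWeight_extremalWord_q J
    rw [← h] at e1 e2
    have hk : (B.length : ℤ) = J + A.length := by omega
    have hl : A.length = 0 := by
      by_contra hl
      have : (1 : ℤ) ≤ A.length := by omega
      rw [hk] at hB'
      nlinarith
    rw [hl] at hk h2
    have hBJ : B.length = J := by omega
    rw [hBJ] at hBs gB hB' h2 h3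
    rcases hBs with hBs | hBs
    · rw [gB (by nlinarith), extremalWord_q]
      exact (hBs.trans (List.reverse_perm _).symm).map _
    · nlinarith

end ExtremalWords

/-! ### Straightening words with coefficients polynomial in the length. -/

section WordReduction

open Polynomial

variable {V : Type*} [AddCommGroup V] [Module ℂ V]

/-- A sequence of modules and highest-weight vectors with parameters polynomial in the index. -/
structure IsHWFamily (t : ℂ) (ρ : ℕ → Mode → Module.End ℂ V) (θ h ℓ : ℂ[X]) (e : ℕ → V) :
    Prop where
  isN2Module : ∀ M : ℕ, IsN2Module t (θ.eval (M : ℂ)) (ρ M)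
  isMassiveHW : ∀ M : ℕ,
    IsMassiveHW t (θ.eval (M : ℂ)) (ρ M) (h.eval (M : ℂ)) (ℓ.eval (M : ℂ)) (e M)

/-- Any two generators commute or anticommute up to linear and scalar terms. -/
theorem exists_superbracket {t : ℂ} {ρ : ℕ → Mode → Module.End ℂ V} {θ : ℂ[X]}
    (hρ : ∀ M : ℕ, IsN2Module t (θ.eval (M : ℂ)) (ρ M)) (a b : Mode) :
    ∃ (ε : ℂ) (x y : Mode) (p q r : ℂ[X]),
      (p ≠ 0 → x.weight = a.weight + b.weight) ∧ (q ≠ 0 → y.weight = a.weight + b.weight) ∧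
      (r ≠ 0 → 0 = a.weight + b.weight) ∧ ∀ M : ℕ, ρ M a * ρ M b = ε • (ρ M b * ρ M a) +
        p.eval (M : ℂ) • ρ M x + q.eval (M : ℂ) • ρ M y + r.eval (M : ℂ) • 1 := by
  cases a with
  | L m =>
    cases b with
    | L n =>
      -- An absent term is given coefficient 0 and the dummy letter `.L 0`; weights are constrained
      -- only where the coefficient is non-zero.
      refine ⟨1, .L (m + n), .L 0, C ((m : ℂ) - n), 0, 0, by simp [Mode.weight], by simp, by simp,
        fun M => ?_⟩
      rw [sub_eq_iff_eq_add.1 ((hρ M).LL m n)]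
      simp [add_comm]
    | H n =>
      refine ⟨1, .H (m + n), .L 0, C (-(n : ℂ)), 0,
        C (if m + n = 0 then centralCharge t / 6 * ((m : ℂ) ^ 2 + m) else 0),
        by simp [Mode.weight], by simp, fun hr => ?_, fun M => ?_⟩
      · have : m + n = 0 := by by_contra h0; simp [h0] at hr
        simp [Mode.weight, this, Prod.ext_iff]
      · rw [sub_eq_iff_eq_add.1 ((hρ M).LH m n)]
        simp only [eval_C, eval_zero]
        module
    | Q n =>
      refine ⟨1, .Q (m + n), .L 0, -(-θ + C (n : ℂ)), 0, 0, by simp [Mode.weight], by simp,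
        by simp, fun M => ?_⟩
      rw [sub_eq_iff_eq_add.1 ((hρ M).LQ m n)]
      simp [add_comm]
    | G n =>
      refine ⟨1, .G (m + n), .L 0, C (m : ℂ) - (θ + C (n : ℂ)), 0, 0, by simp [Mode.weight],
        by simp, by simp, fun M => ?_⟩
      rw [sub_eq_iff_eq_add.1 ((hρ M).LG m n)]
      simp [add_comm]
  | H m =>
    cases b with
    | L n =>
      refine ⟨1, .H (n + m), .L 0, C (m : ℂ), 0,
        C (-(if n + m = 0 then centralCharge t / 6 * ((n : ℂ) ^ 2 + n) else 0)),
        by simp [Mode.weight, add_comm], by simp, fun hr => ?_, fun M => ?_⟩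
      · have : n + m = 0 := by by_contra h0; simp [h0] at hr
        simp [Mode.weight, add_comm m, this, Prod.ext_iff]
      · rw [sub_eq_iff_eq_add.1 ((hρ M).LH n m)]
        simp only [eval_C, eval_zero]
        module
    | H n =>
      refine ⟨1, .L 0, .L 0, 0, 0, C (if m + n = 0 then centralCharge t / 3 * m else 0),
        by simp, by simp, fun hr => ?_, fun M => ?_⟩
      · have : m + n = 0 := by by_contra h0; simp [h0] at hr
        simp [Mode.weight, this, Prod.ext_iff]
      · rw [sub_eq_iff_eq_add.1 ((hρ M).HH m n)]
        simp only [eval_C, eval_zero]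
        module
    | Q n =>
      refine ⟨1, .Q (m + n), .L 0, -1, 0, 0, by simp [Mode.weight], by simp, by simp,
        fun M => ?_⟩
      rw [sub_eq_iff_eq_add.1 ((hρ M).HQ m n)]
      simp [add_comm]
    | G n =>
      refine ⟨1, .G (m + n), .L 0, 1, 0, 0, by simp [Mode.weight], by simp, by simp,
        fun M => ?_⟩
      rw [sub_eq_iff_eq_add.1 ((hρ M).HG m n)]
      simp [add_comm]
  | Q m =>
    cases b with
    | L n =>
      refine ⟨1, .Q (n + m), .L 0, -θ + C (m : ℂ), 0, 0, by simp [Mode.weight, add_comm], by simp,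
        by simp, fun M => ?_⟩
      rw [sub_eq_iff_eq_add.1 ((hρ M).LQ n m)]
      simp only [eval_C, eval_zero, eval_add, eval_neg]
      module
    | H n =>
      refine ⟨1, .Q (n + m), .L 0, 1, 0, 0, by simp [Mode.weight, add_comm], by simp, by simp,
        fun M => ?_⟩
      rw [sub_eq_iff_eq_add.1 ((hρ M).HQ n m)]
      simp only [eval_one, eval_zero]
      module
    | Q n =>
      refine ⟨-1, .L 0, .L 0, 0, 0, 0, by simp, by simp, by simp, fun M => ?_⟩
      rw [eq_neg_of_add_eq_zero_left ((hρ M).QQ m n)]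
      simp
    | G n =>
      refine ⟨-1, .L (n + m), .H (n + m), C 2, -(2 * (-θ + C (m : ℂ))),
        if n + m = 0 then C (centralCharge t / 3) * ((θ + C (n : ℂ)) ^ 2 + (θ + C (n : ℂ))) else 0,
        by simp [Mode.weight, add_comm], by simp [Mode.weight, add_comm], fun hr => ?_, fun M => ?_⟩
      · have : n + m = 0 := by by_contra h0; simp [h0] at hr
        simp [Mode.weight, add_comm m, this, Prod.ext_iff]
      · rw [eq_sub_of_add_eq' ((hρ M).GQ n m)]
        split_ifs <;> simp <;> module
  | G m =>
    cases b with
    | L n =>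
      refine ⟨1, .G (n + m), .L 0, -(C (n : ℂ) - (θ + C (m : ℂ))), 0, 0,
        by simp [Mode.weight, add_comm], by simp, by simp, fun M => ?_⟩
      rw [sub_eq_iff_eq_add.1 ((hρ M).LG n m)]
      simp only [eval_C, eval_zero, eval_add, eval_neg, eval_sub]
      module
    | H n =>
      refine ⟨1, .G (n + m), .L 0, -1, 0, 0, by simp [Mode.weight, add_comm], by simp, by simp,
        fun M => ?_⟩
      rw [sub_eq_iff_eq_add.1 ((hρ M).HG n m)]
      simp only [eval_one, eval_zero, eval_neg]
      module
    | Q n =>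
      refine ⟨-1, .L (m + n), .H (m + n), C 2, -(2 * (-θ + C (n : ℂ))),
        if m + n = 0 then C (centralCharge t / 3) * ((θ + C (m : ℂ)) ^ 2 + (θ + C (m : ℂ))) else 0,
        by simp [Mode.weight], by simp [Mode.weight], fun hr => ?_, fun M => ?_⟩
      · have : m + n = 0 := by by_contra h0; simp [h0] at hr
        simp [Mode.weight, this, Prod.ext_iff]
      · rw [eq_sub_of_add_eq ((hρ M).GQ m n)]
        split_ifs <;> simp <;> module
    | G n =>
      refine ⟨-1, .L 0, .L 0, 0, 0, 0, by simp, by simp, by simp, fun M => ?_⟩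
      rw [eq_neg_of_add_eq_zero_left ((hρ M).GG m n)]
      simp

/-- Sequences obtained from `e` by combinations, with coefficients polynomial in the index, of
words of length less than `n` and of weight `κ`. -/
def wordSpan (ρ : ℕ → Mode → Module.End ℂ V) (e : ℕ → V) (n : ℕ) (κ : ℤ × ℤ) :
    Submodule ℂ (ℕ → V) :=
  Submodule.span ℂ {f | ∃ (w : List Mode) (c : ℂ[X]), w.length < n ∧ wordWeight w = κ ∧
    f = fun M : ℕ => c.eval (M : ℂ) • wordOp (ρ M) w (e M)}

variable {ρ : ℕ → Mode → Module.End ℂ V} {e : ℕ → V}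

theorem smul_word_mem_wordSpan (c : ℂ[X]) {w : List Mode} {n : ℕ} {κ : ℤ × ℤ} (hn : w.length < n)
    (hw : c ≠ 0 → wordWeight w = κ) :
    (fun M : ℕ => c.eval (M : ℂ) • wordOp (ρ M) w (e M)) ∈ wordSpan ρ e n κ := by
  by_cases hc : c = 0
  · convert (wordSpan ρ e n κ).zero_mem
    simp [hc]
  · exact Submodule.subset_span ⟨w, c, hn, hw hc, rfl⟩

theorem mode_apply_mem_wordSpan (a : Mode) {f : ℕ → V} {n : ℕ} {κ : ℤ × ℤ}
    (hf : f ∈ wordSpan ρ e n κ) :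
    (fun M => ρ M a (f M)) ∈ wordSpan ρ e (n + 1) (a.weight + κ) := by
  induction hf using Submodule.span_induction with
  | mem f hf =>
    obtain ⟨w, c, hw, hκ, rfl⟩ := hf
    refine Submodule.subset_span ⟨a :: w, c, by simpa using hw, by rw [wordWeight_cons, hκ], ?_⟩
    funext M
    simp [wordOp_cons]
  | zero => convert Submodule.zero_mem _; simp
  | add f g _ _ hf hg => convert Submodule.add_mem _ hf hg; simp
  | smul c f _ hf => convert Submodule.smul_mem _ c hf; simp

/-- Reordering a word changes it by a factor and by shorter words of the same weight. -/
theorem exists_sub_smul_mem_wordSpan_of_perm {t : ℂ} {θ : ℂ[X]}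
    (hρ : ∀ M : ℕ, IsN2Module t (θ.eval (M : ℂ)) (ρ M)) {u w : List Mode} (h : u.Perm w) :
    ∃ ε : ℂ, (fun M : ℕ => wordOp (ρ M) u (e M) - ε • wordOp (ρ M) w (e M)) ∈
      wordSpan ρ e u.length (wordWeight u) := by
  induction h with
  | nil => exact ⟨1, by convert Submodule.zero_mem _; simp⟩
  | cons a _ ih =>
    obtain ⟨ε, h⟩ := ih
    refine ⟨ε, ?_⟩
    rw [wordWeight_cons, List.length_cons]
    convert mode_apply_mem_wordSpan a h using 1
    funext M
    simp [wordOp_cons]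
  | swap b a w =>
    obtain ⟨ε, x, y, p, q, r, hp, hq, hr, h⟩ := exists_superbracket hρ a b
    refine ⟨ε, ?_⟩
    convert Submodule.add_mem _ (Submodule.add_mem _
      (smul_word_mem_wordSpan (ρ := ρ) (e := e) p (w := x :: w) (n := (a :: b :: w).length)
        (κ := wordWeight (a :: b :: w)) (by simp) fun h0 => ?_)
      (smul_word_mem_wordSpan q (w := y :: w) (by simp) fun h0 => ?_))
      (smul_word_mem_wordSpan r (w := w) (by simp) fun h0 => ?_) using 1
    · funext M
      simp only [wordOp_cons, ← mul_assoc, h]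
      simp
      module
    · rw [wordWeight_cons, wordWeight_cons, wordWeight_cons, hp h0, add_assoc]
    · rw [wordWeight_cons, wordWeight_cons, wordWeight_cons, hq h0, add_assoc]
    · rw [wordWeight_cons, wordWeight_cons, ← add_assoc, ← hr h0, zero_add]
  | trans h₁ _ ih₁ ih₂ =>
    obtain ⟨ε₁, h₁'⟩ := ih₁
    obtain ⟨ε₂, h₂'⟩ := ih₂
    refine ⟨ε₁ * ε₂, ?_⟩
    rw [← h₁.length_eq, ← h₁.wordWeight_eq] at h₂'
    convert Submodule.add_mem _ h₁' (Submodule.smul_mem _ ε₁ h₂') using 1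
    funext M
    simp only [Pi.add_apply, Pi.smul_apply]
    module

/-- Generators other than creation operators act on the vectors `e` by scalars. -/
theorem IsHWFamily.exists_eval_smul {t : ℂ} {θ h ℓ : ℂ[X]} (he : IsHWFamily t ρ θ h ℓ e)
    {a : Mode} (ha : ¬ a.IsCreation) :
    ∃ p : ℂ[X], (p ≠ 0 → a.weight = 0) ∧ ∀ M : ℕ, ρ M a (e M) = p.eval (M : ℂ) • e M := by
  cases a with
  | L n =>
    rcases (not_lt.1 ha).eq_or_lt with rfl | hn
    · refine ⟨ℓ - θ * h + C (centralCharge t / 6) * (θ ^ 2 - θ), fun _ => rfl, fun M => ?_⟩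
      rw [(he.isMassiveHW M).L_zero_apply]
      simp
    · exact ⟨0, by simp, fun M => by simpa using (he.isMassiveHW M).L_pos n hn⟩
  | H n =>
    rcases (not_lt.1 ha).eq_or_lt with rfl | hn
    · refine ⟨h - C (centralCharge t / 3) * θ, fun _ => rfl, fun M => ?_⟩
      rw [(he.isMassiveHW M).H_zero_apply]
      simp
    · exact ⟨0, by simp, fun M => by simpa using (he.isMassiveHW M).H_pos n hn⟩
  | Q n => exact ⟨0, by simp, fun M => by simpa using (he.isMassiveHW M).Q_pos n (not_le.1 ha)⟩
  | G n => exact ⟨0, by simp, fun M => by simpa using (he.isMassiveHW M).G_nonneg n (not_lt.1 ha)⟩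

/-- A word of extremal weight acts on the vectors `e` as a polynomial multiple of the extremal
word. -/
theorem IsHWFamily.exists_eval_smul_extremalWord {t : ℂ} {θ h ℓ : ℂ[X]}
    (he : IsHWFamily t ρ θ h ℓ e) {s : Fermion} {J : ℕ} {w : List Mode}
    (hw : wordWeight w = wordWeight (extremalWord s J)) :
    ∃ c : ℂ[X], ∀ M : ℕ, wordOp (ρ M) w (e M) =
      c.eval (M : ℂ) • wordOp (ρ M) (extremalWord s J) (e M) := by
  induction hn : w.length using Nat.strong_induction_on generalizing w with
  | _ n ih =>
  have hspan : ∀ f ∈ wordSpan ρ e w.length (wordWeight w), ∃ c : ℂ[X], ∀ M : ℕ, f M =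
      c.eval (M : ℂ) • wordOp (ρ M) (extremalWord s J) (e M) := fun f hf => by
    induction hf using Submodule.span_induction with
    | mem f hf =>
      obtain ⟨u, c, hu, hκ, rfl⟩ := hf
      obtain ⟨c', hc'⟩ := ih _ (hn ▸ hu) (hκ.trans hw) rfl
      exact ⟨c * c', fun M => by simp [hc', smul_smul]⟩
    | zero => exact ⟨0, by simp⟩
    | add f g _ _ hf hg =>
      obtain ⟨c, hc⟩ := hf
      obtain ⟨d, hd⟩ := hg
      exact ⟨c + d, fun M => by simp [hc, hd, add_smul]⟩
    | smul a f _ hf =>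
      obtain ⟨c, hc⟩ := hf
      exact ⟨C a * c, fun M => by simp [hc, smul_smul]⟩
  -- Shorter words of the same weight are covered by induction, so any convenient order of the
  -- letters may be chosen.
  have hperm : ∀ u, w.Perm u → (∃ c : ℂ[X], ∀ M : ℕ, wordOp (ρ M) u (e M) =
      c.eval (M : ℂ) • wordOp (ρ M) (extremalWord s J) (e M)) →
      ∃ c : ℂ[X], ∀ M : ℕ, wordOp (ρ M) w (e M) =
        c.eval (M : ℂ) • wordOp (ρ M) (extremalWord s J) (e M) := by
    rintro u hu ⟨c, hc⟩
    obtain ⟨ε, hε⟩ := exists_sub_smul_mem_wordSpan_of_perm (e := e) he.isN2Module hu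
    obtain ⟨d, hd⟩ := hspan _ hε
    refine ⟨d + C ε * c, fun M => ?_⟩
    rw [eq_add_of_sub_eq (hd M), hc M, smul_smul, ← add_smul]
    simp
  by_cases hcr : ∀ a ∈ w, a.IsCreation
  -- Either no letter of square zero is repeated, and the word is a permutation of the extremal one,
  -- or such a pair can be moved to the right end, where it gives 0.
  · by_cases hsq : w.Pairwise fun a b => a = b → ∃ M, ρ M a * ρ M a ≠ 0
    · refine hperm _ (perm_extremalWord hcr (hsq.imp ?_) (hsq.imp ?_) hw) ⟨1, by simp⟩
      · rintro a b hab k rfl rfl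
        obtain ⟨M, hM⟩ := hab rfl
        exact hM ((he.isN2Module M).G_mul_self k)
      · rintro a b hab k rfl rfl
        obtain ⟨M, hM⟩ := hab rfl
        exact hM ((he.isN2Module M).Q_mul_self k)
    · rw [List.pairwise_iff_forall_sublist] at hsq
      push Not at hsq
      obtain ⟨a, b, hsub, rfl, hM⟩ := hsq
      obtain ⟨u, hu⟩ := hsub.exists_perm_append
      refine hperm (u ++ [a, a]) (hu.trans List.perm_append_comm) ⟨0, fun M => ?_⟩
      rw [wordOp_append, wordOp_cons, wordOp_cons, ← mul_assoc (ρ M a), hM M]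
      simp
  -- A letter that is not a creation operator is moved to the right end, where it becomes a scalar.
  -- This scalar polynomial is zero unless the letter has weight zero, so what remains is a shorter
  -- word of the same weight.
  · push Not at hcr
    obtain ⟨a, ha, hac⟩ := hcr
    obtain ⟨u, u', rfl⟩ := List.append_of_mem ha
    obtain ⟨p, hp, hpe⟩ := he.exists_eval_smul hac
    have hu : (u ++ a :: u').Perm ((u ++ u') ++ [a]) :=
      List.perm_middle.trans (List.perm_append_singleton _ _).symm
    refine hperm _ hu (hspan _ ?_)
    convert smul_word_mem_wordSpan p (w := u ++ u') (n := (u ++ a :: u').length)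
      (κ := wordWeight (u ++ a :: u')) (by simp) fun h0 => ?_ using 3 with M
    · rw [wordOp_append, Module.End.mul_apply]
      simp [wordOp, hpe]
    · rw [hu.wordWeight_eq, wordWeight_append _ [a]]
      simp [wordWeight, hp h0]

end WordReduction

/-! ### The functional that detects the continued state. -/

section Nonvanishing

open Polynomial

variable {V : Type*} [AddCommGroup V] [Module ℂ V]

/-- The change of labels of `rebase`. -/
def Mode.shift (j : ℤ) : Mode → Mode
  | .L n => .L n
  | .H n => .H n
  | .Q n => .Q (n - j)
  | .G n => .G (n + j)

theorem wordOp_rebase (j : ℤ) (ρ : Mode → Module.End ℂ V) (w : List Mode) :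
    wordOp (rebase j ρ) w = wordOp ρ (w.map (Mode.shift j)) := by
  have : rebase j ρ = ρ ∘ Mode.shift j := by
    funext m
    cases m <;> rfl
  simp [wordOp, this]

theorem modeProduct_eq_wordOp (ρ : Mode → Module.End ℂ V) (s : Fermion) (J : ℕ) :
    modeProduct ρ s J = wordOp ρ (extremalWord s J) := by
  induction J with
  | zero => simp [modeProduct, extremalWord, wordOp]
  | succ J ih => cases s <;> simp [modeProduct, extremalWord, wordOp_cons, ih]

/-- After M modes the twist has moved by ±M, and relative to it the next J modes carry the same
labels as the first J modes did. -/
theorem modeProduct_add (ρ : Mode → Module.End ℂ V) (s : Fermion) (M J : ℕ) :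
    modeProduct ρ s (M + J) =
      wordOp (rebase (s.sign * M) ρ) (extremalWord s J) * modeProduct ρ s M := by
  induction J with
  | zero => simp [extremalWord, wordOp]
  | succ J ih =>
    rw [← add_assoc]
    cases s <;>
    · simp only [modeProduct, extremalWord, wordOp_cons, ih, mul_assoc, rebase, Fermion.sign]
      congr 3
      push_cast
      ring

theorem IsMassiveHW.isHWFamily_modeProduct {t θ h ℓ : ℂ} (ht : t ≠ 0)
    {ρ : Mode → Module.End ℂ V} {v : V} (hρ : IsN2Module t θ ρ) (hv : IsMassiveHW t θ ρ h ℓ v)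
    (s : Fermion) :
    IsHWFamily t (fun M => rebase (s.sign * M) ρ) (C θ + C (s.sign : ℂ) * X)
      (C h - C (2 / t) * (C (s.sign : ℂ) * X))
      (C ℓ + C (s.sign : ℂ) * X * (C h - C (1 / t) * (C (s.sign : ℂ) * X + 1)))
      fun M => modeProduct ρ s M v where
  isN2Module M := by simpa using hρ.rebase (s.sign * M)
  isMassiveHW M := by simpa using hv.flow ht hρ s M

/-- Words are eigenvectors for the adjoint action of `𝓛_0 + κ 𝓗_0`. -/
theorem IsN2Module.commutator_wordOp {t θ : ℂ} {ρ : Mode → Module.End ℂ V}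
    (hρ : IsN2Module t θ ρ) (κ : ℂ) (w : List Mode) :
    (ρ (.L 0) + κ • ρ (.H 0)) * wordOp ρ w = wordOp ρ w * (ρ (.L 0) + κ • ρ (.H 0)) +
      ((κ - θ) * (wordWeight w).1 - (wordWeight w).2) • wordOp ρ w := by
  have key : ∀ a : Mode, (ρ (.L 0) + κ • ρ (.H 0)) * ρ a = ρ a * (ρ (.L 0) + κ • ρ (.H 0)) +
      ((κ - θ) * a.weight.1 - a.weight.2) • ρ a := by
    intro a
    cases a with
    | L n =>
      have h1 := sub_eq_iff_eq_add.1 (hρ.LL 0 n)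
      have h2 := hρ.LH n 0
      rw [sub_eq_iff_eq_add, add_comm n 0, zero_add] at h2
      have h3 : (if n = 0 then centralCharge t / 6 * ((n : ℂ) ^ 2 + n) else 0) = 0 := by
        split_ifs with h <;> simp [h]
      simp only [h3, Int.cast_zero, neg_zero, zero_smul, zero_add] at h2
      simp only [add_mul, mul_add, smul_mul_assoc, mul_smul_comm, h1, h2, Mode.weight, zero_add]
      push_cast
      module
    | H n =>
      have h1 := sub_eq_iff_eq_add.1 (hρ.LH 0 n)
      have h2 := sub_eq_iff_eq_add.1 (hρ.HH 0 n)
      simp only [Int.cast_zero, mul_zero, ite_self, zero_smul, zero_add, ne_eq, OfNat.ofNat_ne_zero,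
        not_false_eq_true, zero_pow, add_zero] at h1 h2
      simp only [add_mul, mul_add, smul_mul_assoc, mul_smul_comm, h1, h2, Mode.weight]
      push_cast
      module
    | Q n =>
      have h1 := sub_eq_iff_eq_add.1 (hρ.LQ 0 n)
      have h2 := sub_eq_iff_eq_add.1 (hρ.HQ 0 n)
      simp only [add_mul, mul_add, smul_mul_assoc, mul_smul_comm, h1, h2, Mode.weight, zero_add]
      push_cast
      module
    | G n =>
      have h1 := sub_eq_iff_eq_add.1 (hρ.LG 0 n)
      have h2 := sub_eq_iff_eq_add.1 (hρ.HG 0 n)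
      simp only [add_mul, mul_add, smul_mul_assoc, mul_smul_comm, h1, h2, Mode.weight, zero_add]
      push_cast
      module
  induction w with
  | nil => simp [wordOp, wordWeight]
  | cons a w ih =>
    rw [wordOp_cons, ← mul_assoc, key a, add_mul, mul_assoc, ih, wordWeight_cons]
    simp only [mul_add, mul_assoc, smul_mul_assoc, mul_smul_comm, Prod.fst_add, Prod.snd_add]
    push_cast
    module

theorem IsMassiveHW.exists_eigenvalue {t θ h ℓ : ℂ} {ρ : Mode → Module.End ℂ V} {v : V}
    (hρ : IsN2Module t θ ρ) (hv : IsMassiveHW t θ ρ h ℓ v) (κ : ℂ) :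
    ∃ μ : ℂ, ∀ w : List Mode, (ρ (.L 0) + κ • ρ (.H 0)) (wordOp ρ w v) =
      (μ + ((κ - θ) * (wordWeight w).1 - (wordWeight w).2)) • wordOp ρ w v := by
  refine ⟨ℓ - θ * h + centralCharge t / 6 * (θ ^ 2 - θ) + κ * (h - centralCharge t / 3 * θ),
    fun w => ?_⟩
  have := LinearMap.congr_fun (hρ.commutator_wordOp κ w) v
  simp only [Module.End.mul_apply, LinearMap.add_apply, LinearMap.smul_apply, hv.L_zero_apply,
    hv.H_zero_apply, map_add, map_smul] at this
  rw [LinearMap.add_apply, LinearMap.smul_apply, this]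
  module

/-- A sum of eigenvectors that vanishes has vanishing partial sums over each eigenvalue. -/
theorem sum_filter_eigenvalue_eq_zero {ι : Type*} (T : Module.End ℂ V) (S : Finset ι) (y : ι → V)
    (μ : ι → ℂ) (hy : ∀ i ∈ S, T (y i) = μ i • y i) (h : ∑ i ∈ S, y i = 0) (ν : ℂ) :
    ∑ i ∈ S with μ i = ν, y i = 0 := by
  classical
  have hmem : ∀ c : ℂ, ∑ i ∈ S with μ i = c, y i ∈ T.eigenspace c := fun c =>
    Submodule.sum_mem _ fun i hi => by
      obtain ⟨hi, hc⟩ := Finset.mem_filter.1 hi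
      exact Module.End.mem_eigenspace_iff.2 (hc ▸ hy i hi)
  by_cases hν : ν ∈ S.image μ
  · rw [← Finset.sum_fiberwise_of_maps_to (t := S.image μ) (g := μ)
      fun i hi => Finset.mem_image_of_mem _ hi] at h
    exact (iSupIndep_iff_finsetSum_eq_zero_imp_eq_zero _).1 T.eigenspaces_iSupIndep _ _
      (fun c _ => hmem c) h ν hν
  · rw [Finset.filter_false_of_mem, Finset.sum_empty]
    rintro i hi rfl
    exact hν (Finset.mem_image_of_mem _ hi)

/-- A word applied to a product of modes, brought to the length `N + j`, is a polynomial multiple of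
the product of that length, or has another weight. -/
theorem IsMassiveHW.exists_coefficient {t θ h ℓ : ℂ} (ht : t ≠ 0)
    {ρ : Mode → Module.End ℂ V} {v : V} (hρ : IsN2Module t θ ρ) (hv : IsMassiveHW t θ ρ h ℓ v)
    (s : Fermion) (j : ℕ) (x : ℤ × List Mode) :
    ∃ c : ℂ[X], ∀ N : ℤ, 0 ≤ N + j → 0 ≤ N + x.1 → ∃ μ ν : ℂ,
      (ρ (.L 0) + (θ + Complex.I) • ρ (.H 0)) (wordOp (rebase (s.sign * N) ρ) (extremalWord s j)
        (evalAt s ρ v N (Finsupp.single x 1))) =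
        μ • wordOp (rebase (s.sign * N) ρ) (extremalWord s j)
          (evalAt s ρ v N (Finsupp.single x 1)) ∧
      (ρ (.L 0) + (θ + Complex.I) • ρ (.H 0)) (modeProduct ρ s (N + j).toNat v) =
        ν • modeProduct ρ s (N + j).toNat v ∧
      (μ = ν → wordOp (rebase (s.sign * N) ρ) (extremalWord s j)
        (evalAt s ρ v N (Finsupp.single x 1)) =
          c.eval (N : ℂ) • modeProduct ρ s (N + j).toNat v) ∧
      (μ ≠ ν → c = 0) := by
  obtain ⟨k, w⟩ := x
  -- Both vectors are built from the common product of length N + m by words `W` and `E` that do not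
  -- depend on N; the minimum makes the numbers of added modes non-negative.
  set m : ℤ := min k j with hm
  set W : List Mode := (extremalWord s j ++ w).map (Mode.shift (s.sign * -m)) ++
    extremalWord s (k - m).toNat with hW
  set E : List Mode := extremalWord s (j - m).toNat with hE
  have hfam := hv.isHWFamily_modeProduct ht hρ s
  have hy : ∀ N : ℤ, 0 ≤ N + j → 0 ≤ N + k →
      wordOp (rebase (s.sign * N) ρ) (extremalWord s j) (evalAt s ρ v N (Finsupp.single (k, w) 1)) =
        wordOp (rebase (s.sign * ((N + m).toNat : ℤ)) ρ) W (modeProduct ρ s (N + m).toNat v) := by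
    intro N hj hk
    have h1 : (N + k).toNat = (N + m).toNat + (k - m).toNat := by omega
    have h2 : s.sign * N = s.sign * -m + s.sign * ((N + m).toNat : ℤ) := by
      rw [← mul_add]; congr 1; omega
    rw [evalAt_single, one_smul, ← Module.End.mul_apply, ← wordOp_append]
    simp only [h1, modeProduct_add]
    rw [h2, ← rebase_rebase, wordOp_rebase, hW, wordOp_append _ (List.map _ _)]
    rfl
  have hp : ∀ N : ℤ, 0 ≤ N + j → 0 ≤ N + k → modeProduct ρ s (N + j).toNat v =
      wordOp (rebase (s.sign * ((N + m).toNat : ℤ)) ρ) E (modeProduct ρ s (N + m).toNat v) := by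
    intro N hj hk
    have h1 : (N + j).toNat = (N + m).toNat + (j - m).toNat := by omega
    rw [h1, modeProduct_add]
    rfl
  have heig : ∀ N : ℤ, ∃ μ : ℂ, ∀ u : List Mode, (ρ (.L 0) + (θ + Complex.I) • ρ (.H 0))
      (wordOp (rebase (s.sign * ((N + m).toNat : ℤ)) ρ) u (modeProduct ρ s (N + m).toNat v)) =
      (μ + ((Complex.I - (s.sign * ((N + m).toNat : ℤ) : ℤ)) * (wordWeight u).1 -
        (wordWeight u).2)) • wordOp (rebase (s.sign * ((N + m).toNat : ℤ)) ρ) u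
          (modeProduct ρ s (N + m).toNat v) := by
    intro N
    obtain ⟨μ, hμ⟩ := (hv.flow ht hρ s (N + m).toNat).exists_eigenvalue
      (by simpa only [Int.cast_mul, Int.cast_natCast] using
        hρ.rebase (s.sign * (N + m).toNat)) (θ + Complex.I)
    refine ⟨μ, fun u => (hμ u).trans ?_⟩
    push_cast
    congr 3
    ring
  by_cases hwt : wordWeight W = wordWeight E
  · obtain ⟨c, hc⟩ := hfam.exists_eval_smul_extremalWord hwt
    -- The coefficient `c` is polynomial in the base length N + m, hence the substitution.
    refine ⟨c.comp (X + C (m : ℂ)), fun N hj hk => ?_⟩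
    obtain ⟨μ, hμ⟩ := heig N
    rw [hy N hj hk, hp N hj hk]
    refine ⟨_, _, hμ W, hμ E, fun _ => ?_, fun h => absurd (by rw [hwt]) h⟩
    rw [hc]
    have : ((N + m).toNat : ℂ) = N + m := by
      have : ((N + m).toNat : ℤ) = N + m := Int.toNat_of_nonneg (by omega)
      exact_mod_cast congrArg (Int.cast : ℤ → ℂ) this
    rw [eval_comp, eval_add, eval_X, eval_C, ← this]
  · refine ⟨0, fun N hj hk => ?_⟩
    obtain ⟨μ, hμ⟩ := heig N
    rw [hy N hj hk, hp N hj hk]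
    refine ⟨_, _, hμ W, hμ E, fun h => absurd ?_ hwt, fun _ => rfl⟩
    -- This is why `Complex.I` was added to θ: the imaginary part of the eigenvalue shift is the
    -- integral charge, and at equal charge the real part determines the label sum. Different
    -- weights thus have different eigenvalues.
    have h1 := congrArg Complex.im h
    have h2 := congrArg Complex.re h
    simp at h1
    simp [h1] at h2
    exact Prod.ext h1 h2

/-- The coefficient functional of the product of modes: it vanishes on the relations that hold at an
integral length. -/
theorem IsMassiveHW.exists_coefficients {t θ h ℓ : ℂ} (ht : t ≠ 0)
    {ρ : Mode → Module.End ℂ V} {v : V} (hρ : IsN2Module t θ ρ) (hv : IsMassiveHW t θ ρ h ℓ v)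
    (s : Fermion) (hne : ∀ N : ℕ, modeProduct ρ s N v ≠ 0) (j : ℕ) :
    ∃ c : ℤ × List Mode → ℂ[X], c (0, []) = 1 ∧ ∀ N : ℤ, 0 ≤ N + j → ∀ r : FormalState,
      (∀ x ∈ r.support, 0 ≤ N + x.1) → evalAt s ρ v N r = 0 →
        (r.sum fun x a => a * (c x).eval (N : ℂ)) = 0 := by
  choose c hc using hv.exists_coefficient ht hρ s j
  refine ⟨c, ?_, fun N hj r hr h0 => ?_⟩
  -- At every N ≥ 0, the j extra modes turn the product of length N into that of length N + j, so
  -- the polynomial takes the value 1.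
  · refine Polynomial.eq_of_infinite_eval_eq _ _
      ((Set.infinite_range_of_injective (Nat.cast_injective (R := ℂ))).mono ?_)
    rintro _ ⟨N, rfl⟩
    obtain ⟨μ, ν, h1, h2, h3, -⟩ := hc (0, []) N (by omega) (by simp)
    have hy : wordOp (rebase (s.sign * N) ρ) (extremalWord s j)
        (evalAt s ρ v N (Finsupp.single (0, []) 1)) = modeProduct ρ s (N + j) v := by
      rw [modeProduct_add]
      simp [evalAt_single, wordOp]
    have hN : ((N : ℤ) + j).toNat = N + j := by omega
    rw [hy] at h1 h3
    rw [hN] at h2 h3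
    have hμν : μ = ν := smul_left_injective ℂ (hne (N + j)) (h1.symm.trans h2)
    have := h3 hμν
    simpa using (smul_left_injective ℂ (hne (N + j)) ((one_smul ℂ _).trans this)).symm
  · have hcx : ∀ x : ℤ × List Mode, ∃ μ ν : ℂ, x ∈ r.support → _ := fun x => by
      by_cases hx : x ∈ r.support
      · obtain ⟨μ, ν, h⟩ := hc x N hj (hr x hx)
        exact ⟨μ, ν, fun _ => h⟩
      · exact ⟨0, 0, fun h => absurd h hx⟩
    choose μ ν hμν using hcx
    have hexp : r = ∑ x ∈ r.support, r x • Finsupp.single x (1 : ℂ) := by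
      conv_lhs => rw [← Finsupp.sum_single r]
      simp [Finsupp.sum]
    have hsum := congrArg (wordOp (rebase (s.sign * N) ρ) (extremalWord s j)) h0
    rw [hexp, map_sum, map_sum, map_zero] at hsum
    simp only [map_smul] at hsum
    by_cases hsupp : r.support = ∅
    · simp [Finsupp.sum, hsupp]
    obtain ⟨x₀, hx₀⟩ := Finset.nonempty_iff_ne_empty.2 hsupp
    have hν : ∀ x ∈ r.support, ν x = ν x₀ := fun x hx =>
      smul_left_injective ℂ (hne (N + j).toNat)
        ((hμν x hx).2.1.symm.trans (hμν x₀ hx₀).2.1)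
    -- Projecting onto the eigenvalue of the product of length N + j leaves only its multiples;
    -- symbols with another eigenvalue have coefficient polynomial 0.
    have hproj := sum_filter_eigenvalue_eq_zero
      (ρ (.L 0) + (θ + Complex.I) • ρ (.H 0)) r.support _ μ (fun x hx => by
        rw [map_smul, (hμν x hx).1, smul_comm]) hsum (ν x₀)
    have : (r.sum fun x a => a * (c x).eval (N : ℂ)) • modeProduct ρ s (N + j).toNat v = 0 := by
      rw [← hproj, Finsupp.sum, Finset.sum_smul, Finset.sum_filter]
      refine Finset.sum_congr rfl fun x hx => ?_
      split_ifs with hx'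
      · rw [(hμν x hx).2.2.1 (hx'.trans (hν x hx).symm), mul_smul]
      · rw [(hμν x hx).2.2.2 fun h => hx' (h.trans (hν x hx))]
        simp
    exact (smul_eq_zero.1 this).resolve_right (hne _)

/-- The continued state does not vanish if the products of modes do not. -/
theorem IsMassiveHW.continuedState_ne_zero {t θ h ℓ : ℂ} (ht : t ≠ 0)
    {ρ : Mode → Module.End ℂ V} {v : V} (hρ : IsN2Module t θ ρ) (hv : IsMassiveHW t θ ρ h ℓ v)
    (s : Fermion) (hne : ∀ N : ℕ, modeProduct ρ s N v ≠ 0) (z : ℂ) :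
    _root_.continuedState s ρ v z ≠ 0 := by
  -- For an integral z, possibly negative, j is taken so large that the product of length z + j is
  -- an actual one.
  obtain ⟨j, hj⟩ : ∃ j : ℕ, ∀ n : ℤ, z = n → 0 ≤ n + j := by
    by_cases hz : ∃ n : ℤ, z = n
    · obtain ⟨n, rfl⟩ := hz
      refine ⟨n.natAbs, fun m hm => ?_⟩
      rw [← Int.cast_injective hm]
      omega
    · exact ⟨0, fun n hn => absurd ⟨n, hn⟩ hz⟩
  obtain ⟨c, hc, hcr⟩ := hv.exists_coefficients ht hρ s hne j
  let φ : FormalState →ₗ[ℂ] ℂ := Finsupp.linearCombination ℂ fun x => (c x).eval z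
  have hφ : continuedRelations s ρ v z ≤ LinearMap.ker φ := by
    refine Submodule.span_le.2 ?_
    rintro r (⟨f, ⟨K, hf⟩, rfl⟩ | ⟨n, rfl, hsupp, hr⟩)
    · have hat : ∀ y : ℂ, ((f.at y).sum fun x a => a * (c x).eval y) =
          (f.sum fun x p => p * c x).eval y := fun y => by
        rw [FormalFamily.at, Finsupp.sum_mapRange_index (by simp), Finsupp.sum, Finsupp.sum,
          eval_finsetSum]
        simp
      -- The polynomial vanishes at all integers beyond both the threshold `K` and the bound `B`,
      -- which makes all occurring lengths non-negative.
      have hzero : (f.sum fun x p => p * c x) = 0 := by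
        obtain ⟨B, hB⟩ : ∃ B : ℕ, ∀ x ∈ f.support, -x.1 ≤ B := by
          refine ⟨f.support.sup fun x => x.1.natAbs, fun x hx => ?_⟩
          have := Finset.le_sup (f := fun x : ℤ × List Mode => x.1.natAbs) hx
          omega
        refine Polynomial.eq_of_infinite_eval_eq _ _
          ((Set.infinite_range_of_injective (f := fun n : ℕ => ((K.natAbs + B + n : ℤ) : ℂ))
            fun a b hab => by simpa using hab).mono ?_)
        rintro _ ⟨n, rfl⟩
        rw [Set.mem_ofPred_eq, ← hat, eval_zero]
        refine hcr _ (by omega) _ (fun x hx => ?_) (hf _ (by omega))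
        have := hB x (Finsupp.support_mapRange hx)
        omega
      rw [SetLike.mem_coe, LinearMap.mem_ker]
      change (Finsupp.linearCombination ℂ _) _ = _
      rw [Finsupp.linearCombination_apply]
      simp only [smul_eq_mul]
      rw [hat, hzero, eval_zero]
    · exact hcr n (hj n rfl) r hsupp hr
  intro h0
  rw [_root_.continuedState, Submodule.mkQ_apply, Submodule.Quotient.mk_eq_zero] at h0
  have := hφ h0
  simp [φ, hc] at this

end Nonvanishing

/-! ### Verma modules and the converse statements. -/

section Verma

variable {V : Type*} [AddCommGroup V] [Module ℂ V]

theorem sort_range_ge (N : ℕ) : (Finset.range N).sort (· ≥ ·) = (List.range N).reverse := by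
  refine List.Perm.eq_of_pairwise' (r := (· ≥ ·)) (Finset.pairwise_sort _ _) ?_ ?_
  · rw [List.pairwise_reverse]
    exact List.pairwise_le_range
  · rw [List.perm_ext_iff_of_nodup (Finset.sort_nodup _ _)
      (List.nodup_reverse.2 List.nodup_range)]
    simp

/-- The product is itself a basis monomial: the one whose only factors are the first N modes of one
fermion, in decreasing order of index. -/
theorem IsMassiveVerma.modeProduct_ne_zero {t θ h ℓ : ℂ} {ρ : Mode → Module.End ℂ V} {v : V}
    (hV : IsMassiveVerma t θ ρ h ℓ v) (s : Fermion) (N : ℕ) : modeProduct ρ s N v ≠ 0 := by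
  cases s with
  | g =>
    have := hV.linearIndependent.ne_zero (0, 0, ∅, Finset.range N)
    simpa [creationMonomial, sort_range_ge, modeProduct_eq_wordOp, extremalWord_g, wordOp,
      Function.comp_def] using this
  | q =>
    have := hV.linearIndependent.ne_zero (0, 0, Finset.range N, ∅)
    simpa [creationMonomial, sort_range_ge, modeProduct_eq_wordOp, extremalWord_q, wordOp,
      Function.comp_def] using this

theorem IsMassiveHW.continuedState_ne_zero_iff {t θ h ℓ : ℂ} (ht : t ≠ 0)
    {ρ : Mode → Module.End ℂ V} {v : V} (hρ : IsN2Module t θ ρ) (hv : IsMassiveHW t θ ρ h ℓ v)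
    (s : Fermion) (z : ℂ) :
    _root_.continuedState s ρ v z ≠ 0 ↔ ∀ N : ℕ, modeProduct ρ s N v ≠ 0 :=
  ⟨fun h0 _ hN => h0 (continuedState_eq_zero hN z),
    fun hne => hv.continuedState_ne_zero ht hρ s hne z⟩

theorem IsMassiveHW.eq_zero_of_isTopologicalHW {t θ h ℓ k : ℂ} {ρ : Mode → Module.End ℂ V} {v : V}
    (hv : IsMassiveHW t θ ρ h ℓ v) (hk : IsTopologicalHW t θ ρ k v) (h0 : v ≠ 0) : ℓ = 0 :=
  (smul_eq_zero.1 (hv.L_zero.symm.trans hk.L_zero)).resolve_right h0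

/-- Lowering the twist from θ + 1 to θ subtracts 𝓗_0 + (c/3)(θ + 1) from the 𝓛_0 combination, so its
eigenvalue becomes ℓ - h. -/
theorem IsMassiveHW.eq_of_isTopologicalHW_rebase {t θ h ℓ k : ℂ}
    {ρ : Mode → Module.End ℂ V} {v : V} (hv : IsMassiveHW t (θ + 1) ρ h ℓ v)
    (hk : IsTopologicalHW t θ (rebase (-1) ρ) k v) (h0 : v ≠ 0) : ℓ = h := by
  have h1 := hk.L_zero
  simp only [rebase, hv.H_zero_apply, hv.L_zero_apply] at h1
  have h2 : (ℓ - h) • v = 0 := by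
    rw [← h1]
    module
  exact sub_eq_zero.1 ((smul_eq_zero.1 h2).resolve_right h0)

end Verma

/-! ### Assembly of the theorem. -/

theorem mainTheorem2 {V : Type*} [AddCommGroup V] [Module ℂ V]
    (t : ℂ) (ht : t ≠ 0) (θ θ' h ℓ : ℂ) (ρ : Mode → Module.End ℂ V)
    (hρ : IsN2Module t θ ρ) (v : V) (hv : IsMassiveHW t θ ρ h ℓ v) :
    -- the state `g(θ', θ - 1) |h, ℓ, t; θ⟩`
    (IsN2Module t θ' (gModes ρ θ' θ v) ∧
      IsMassiveHW t θ' (gModes ρ θ' θ v)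
        (h + 2 / t * (θ - θ'))
        (ℓ + (θ' - θ) * (h - 1 / t * (θ' - θ + 1)))
        (gState ρ θ' θ v) ∧
      (gState ρ θ' θ v ≠ 0 ↔ ∀ N : ℕ, modeProduct ρ .g N v ≠ 0) ∧
      (IsMassiveVerma t θ ρ h ℓ v → gState ρ θ' θ v ≠ 0) ∧
      (Lam (θ' - θ) h ℓ t = 0 →
        IsTopologicalHW t θ' (gModes ρ θ' θ v) (h + 2 / t * (θ - θ')) (gState ρ θ' θ v)) ∧
      (gState ρ θ' θ v ≠ 0 → ∀ k : ℂ,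
        IsTopologicalHW t θ' (gModes ρ θ' θ v) k (gState ρ θ' θ v) →
          Lam (θ' - θ) h ℓ t = 0) ∧
      -- integral lengths: the product of modes as an element of `V` itself
      (∀ N : ℕ,
        IsMassiveHW t (θ - N) (rebase (-N) ρ)
          (h + 2 / t * N) (ℓ - N * (h - 1 / t * (1 - N))) (modeProduct ρ .g N v) ∧
        (1 ≤ N → Lam (-N) h ℓ t = 0 →
          IsTopologicalHW t (θ - N) (rebase (-N) ρ) (h + 2 / t * N) (modeProduct ρ .g N v)))) ∧
    -- the state `q(-θ', -θ) |h, ℓ, t; θ⟩`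
    (IsN2Module t (θ' + 1) (qModes ρ θ' θ v) ∧
      IsMassiveHW t (θ' + 1) (qModes ρ θ' θ v)
        (h + 2 / t * (θ - θ' - 1))
        (ℓ + (θ' - θ + 1) * (h - 1 / t * (θ' - θ + 2)))
        (qState ρ θ' θ v) ∧
      (qState ρ θ' θ v ≠ 0 ↔ ∀ N : ℕ, modeProduct ρ .q N v ≠ 0) ∧
      (IsMassiveVerma t θ ρ h ℓ v → qState ρ θ' θ v ≠ 0) ∧
      (Lam (θ' - θ) h ℓ t = 0 →
        IsTopologicalHW t θ' (rebase (-1) (qModes ρ θ' θ v))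
          (h + 2 / t * (θ - θ') - 1) (qState ρ θ' θ v)) ∧
      (qState ρ θ' θ v ≠ 0 → ∀ k : ℂ,
        IsTopologicalHW t θ' (rebase (-1) (qModes ρ θ' θ v)) k (qState ρ θ' θ v) →
          Lam (θ' - θ) h ℓ t = 0) ∧
      -- integral lengths: the product of modes as an element of `V` itself
      (∀ N : ℕ,
        IsMassiveHW t (θ + N) (rebase N ρ)
          (h - 2 / t * N) (ℓ + N * (h - 1 / t * (N + 1))) (modeProduct ρ .q N v) ∧
        (1 ≤ N → Lam (N - 1) h ℓ t = 0 →
          IsTopologicalHW t (θ + N - 1) (rebase (N - 1) ρ)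
            (h - 2 / t * (N - 1) - 1) (modeProduct ρ .q N v)))) := by

  have hg : (Fermion.g.sign : ℂ) * (θ - θ') = θ' - θ := by simp [Fermion.sign]
  have hq : (Fermion.q.sign : ℂ) * (θ' - θ + 1) = θ' - θ + 1 := by simp [Fermion.sign]
  have hgHW : IsMassiveHW t θ' (gModes ρ θ' θ v) (h + 2 / t * (θ - θ'))
      (ℓ + (θ' - θ) * (h - 1 / t * (θ' - θ + 1))) (gState ρ θ' θ v) := by
    have := hv.continuedState ht hρ .g (θ - θ')
    rw [hg] at this
    convert this using 1 <;> first | rfl | ring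
  have hqHW : IsMassiveHW t (θ' + 1) (qModes ρ θ' θ v) (h + 2 / t * (θ - θ' - 1))
      (ℓ + (θ' - θ + 1) * (h - 1 / t * (θ' - θ + 2))) (qState ρ θ' θ v) := by
    have := hv.continuedState ht hρ .q (θ' - θ + 1)
    rw [hq] at this
    convert this using 1 <;> first | rfl | ring
  have hgN : ∀ N : ℕ, IsMassiveHW t (θ - N) (rebase (-N) ρ) (h + 2 / t * N)
      (ℓ - N * (h - 1 / t * (1 - N))) (modeProduct ρ .g N v) := fun N => by
    have := hv.flow ht hρ .g N
    simp only [Fermion.sign, Int.cast_neg, Int.cast_one, neg_one_mul] at this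
    convert this using 1 <;> ring
  have hqN : ∀ N : ℕ, IsMassiveHW t (θ + N) (rebase N ρ) (h - 2 / t * N)
      (ℓ + N * (h - 1 / t * (N + 1))) (modeProduct ρ .q N v) := fun N => by
    simpa only [Fermion.sign, Int.cast_one, one_mul] using hv.flow ht hρ .q N
  have hgne := hv.continuedState_ne_zero_iff ht hρ .g (θ - θ')
  have hqne := hv.continuedState_ne_zero_iff ht hρ .q (θ' - θ + 1)
  -- Λ is twice the 𝓛_0 eigenvalue at twist θ': this is 2ℓ' for 𝓖, and 2(ℓ'' - h'') for 𝓠, whose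
  -- natural twist is θ' + 1. Both directions of the topological criterion rest on this.
  have hgΛ : Lam (θ' - θ) h ℓ t = 2 * (ℓ + (θ' - θ) * (h - 1 / t * (θ' - θ + 1))) := by
    unfold Lam; ring
  have hqΛ : Lam (θ' - θ) h ℓ t = 2 * (ℓ + (θ' - θ + 1) * (h - 1 / t * (θ' - θ + 2)) -
      (h + 2 / t * (θ - θ' - 1))) := by
    unfold Lam; ring
  refine ⟨⟨?_, hgHW, hgne, fun hV => hgne.2 (hV.modeProduct_ne_zero .g), fun hΛ => ?_,
    fun h0 k hk => ?_, fun N => ⟨?_, fun hN hΛ => ?_⟩⟩, ?_, hqHW, hqne,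
    fun hV => hqne.2 (hV.modeProduct_ne_zero .q), fun hΛ => ?_,
    fun h0 k hk => ?_, fun N => ⟨?_, fun hN hΛ => ?_⟩⟩
  · have := isN2Module_continuedModes hρ .g v (θ - θ')
    rwa [hg, add_sub_cancel] at this
  · refine hgHW.isTopologicalHW (by simpa using hgΛ.symm.trans hΛ) ?_
    have := hv.continuedModes_Q_zero ht hρ (θ - θ')
    rwa [neg_sub, hΛ, zero_smul] at this
  · rw [hgΛ, hgHW.eq_zero_of_isTopologicalHW hk h0, mul_zero]
  · exact hgN N
  -- Positive length is needed: the Λ identity removes the last mode, and nothing makes 𝓠_{-θ} kill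
  -- `v` itself.
  · obtain ⟨M, rfl⟩ := Nat.exists_eq_add_of_le' hN
    have hQ := hv.Q_modeProduct_succ ht hρ M
    rw [Nat.cast_add, Nat.cast_one] at hΛ
    rw [hΛ, zero_smul] at hQ
    refine (hgN (M + 1)).isTopologicalHW ?_ ?_
    · rw [Lam] at hΛ
      rw [← mul_eq_zero_iff_left (two_ne_zero (α := ℂ)), ← hΛ]
      push_cast
      ring
    · simpa [rebase] using hQ
  · have := isN2Module_continuedModes hρ .q v (θ' - θ + 1)
    rw [hq] at this
    rwa [show θ + (θ' - θ + 1) = θ' + 1 by ring] at this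
  · have := hqHW.isTopologicalHW_rebase ht (sub_eq_zero.1 (by simpa using hqΛ.symm.trans hΛ)) ?_
    · convert this using 1
      ring
    · have := hv.continuedModes_G_neg_one ht hρ (θ' - θ + 1)
      rwa [add_sub_cancel_right, hΛ, zero_smul] at this
  · rw [hqΛ, hqHW.eq_of_isTopologicalHW_rebase hk h0, sub_self, mul_zero]
  · exact hqN N
  · obtain ⟨M, rfl⟩ := Nat.exists_eq_add_of_le' hN
    have hG := hv.G_modeProduct_succ ht hρ M
    rw [Nat.cast_add, Nat.cast_one, add_sub_cancel_right] at hΛ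
    rw [hΛ, zero_smul] at hG
    have hM := hqN (M + 1)
    -- The twist is written as a successor to match the passage from twist θ + 1 to θ.
    rw [show θ + ((M + 1 : ℕ) : ℂ) = θ + ((M + 1 : ℕ) : ℂ) - 1 + 1 by ring] at hM
    have := hM.isTopologicalHW_rebase ht ?_ ?_
    · rw [rebase_rebase] at this
      convert this using 1 <;> first | ring1 | congr 1
    · rw [← sub_eq_zero, ← mul_eq_zero_iff_left (two_ne_zero (α := ℂ)), ← hΛ, Lam]
      push_cast
      ring
    · simpa [rebase] using hG
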